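/- **Theorem 2.3 (Whittaker transform).** For $a\in\mathbb N=\{1,2,\dots\}$, $p,b,c,\mu\in\mathbb C$, $\lambda,\xi>0$ let $${}_aW^{\lambda,\mu}_{p,b,c,\xi}(z)=\sum_{k=0}^\infty\frac{(-c)^k}{\Gamma(\lambda k+\mu)\,\Gamma\!\left(ak+\frac p\xi+\frac{b+2}2\right)}\left(\frac z2\right)^{2k+p+1}$$ be the generalized Galué type Struve function (principal powers, $1/\Gamma=0$ at the poles of $\Gamma$), let $${}_m\Psi_n\!\left[{(a_i,\alpha_i)_{i\le m}\atop(b_j,\beta_j)_{j\le n}}\middle|z\right]=\sum_{k=0}^\infty\frac{\prod_{i=1}^m\Gamma(a_i+\alpha_ik)}{\prod_{j=1}^n\Gamma(b_j+\beta_jk)}\frac{z^k}{k!}$$ be the generalized Wright function, and let $W_{\tau,\omega}$ be the Whittaker function, that is $$W_{\tau,\omega}(z)=\frac{\Gamma(-2\omega)}{\Gamma(\frac12-\tau-\omega)}M_{\tau,\omega}(z)+\frac{\Gamma(2\omega)}{\Gamma(\frac12-\tau+\omega)}M_{\tau,-\omega}(z),\qquad M_{\tau,\omega}(z)=z^{1/2+\omega}e^{-z/2}{}_1F_1\!\left(\tfrac12+\omega-\tau;2\omega+1;z\right),$$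 extended by its limit in $\omega$ to the values with $2\omega\in\mathbb Z$. Let $\tau,\omega,\zeta,x\in\mathbb C$ with $\Re(\zeta)>0$, $\Re(p)>0$ and $\Re(\zeta\pm\omega)>-\frac12$, and suppose that $\lambda+a>2$, or that $\lambda+a=2$ and $|cx|<1$, or that $c=0$. Then, with the principal square root of $x$, the integral and the series below converge absolutely and $$\int_0^\infty t^{\zeta-1}e^{-t/2}\,W_{\tau,\omega}(t)\;{}_aW^{\lambda,\mu}_{p,b,c,\xi}(x^{1/2}t)\,dt=\left(\frac{\sqrt x}2\right)^{p+1}{}_3\Psi_3\!\left[{(\omega+\zeta+p+\frac32,2),\;(-\omega+\zeta+p+\frac32,2),\;(1,1)\atop(\mu,\lambda),\;(\frac p\xi+\frac b2+1,a),\;(-\tau+\zeta+p+2,2)}\middle|-\frac{cx}4\right].$$ -/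

import Mathlib

open MeasureTheory Filter Topology

noncomputable section

/-- The generalized Galué type Struve function
`∑ₖ (-c)ᵏ / (Γ(λk + μ) Γ(ak + p/ξ + (b+2)/2)) (z/2)^(2k+p+1)` (principal power).
At the poles of `Γ` Mathlib has `Γ = 0`, so that division by it gives the usual value
`1/Γ = 0`. -/
def galueStruve (a : ℕ) (p b c : ℂ) (ξ l : ℝ) (μ : ℂ) (z : ℂ) : ℂ :=
  ∑' k : ℕ, (-c) ^ k /
      (Complex.Gamma (l * k + μ) * Complex.Gamma (a * k + p / ξ + (b + 2) / 2)) *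
    (z / 2) ^ (2 * k + p + 1 : ℂ)

/-- The `k`-th term of the generalized Wright function; the upper parameters are the pairs
`(A i).1 = aᵢ`, `(A i).2 = αᵢ`, the lower ones `(B j).1 = bⱼ`, `(B j).2 = βⱼ`. -/
def wrightTerm {m n : ℕ} (A : Fin m → ℂ × ℝ) (B : Fin n → ℂ × ℝ) (z : ℂ) (k : ℕ) : ℂ :=
  (∏ i, Complex.Gamma ((A i).1 + (A i).2 * k)) * z ^ k /
    ((∏ j, Complex.Gamma ((B j).1 + (B j).2 * k)) * (Nat.factorial k : ℂ))

/-- The generalized Wright hypergeometric function `ₘΨₙ`. -/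
def wrightPsi {m n : ℕ} (A : Fin m → ℂ × ℝ) (B : Fin n → ℂ × ℝ) (z : ℂ) : ℂ :=
  ∑' k : ℕ, wrightTerm A B z k

/-- Kummer's confluent hypergeometric function `₁F₁(α; β; z)`. -/
def kummerF (α β z : ℂ) : ℂ :=
  ∑' k : ℕ, (ascPochhammer ℂ k).eval α / (ascPochhammer ℂ k).eval β *
    (z ^ k / (Nat.factorial k : ℂ))

/-- The Whittaker function `M_{τ,ω}`. -/
def whittakerM (τ ω z : ℂ) : ℂ :=
  z ^ (1 / 2 + ω) * Complex.exp (-z / 2) * kummerF (1 / 2 + ω - τ) (2 * ω + 1) z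

/-- The expression of `W_{τ,ω}` through `M_{τ,ω}` and `M_{τ,-ω}`, meaningful for `2ω ∉ ℤ`. -/
def whittakerConnection (τ ω z : ℂ) : ℂ :=
  Complex.Gamma (-2 * ω) / Complex.Gamma (1 / 2 - τ - ω) * whittakerM τ ω z +
    Complex.Gamma (2 * ω) / Complex.Gamma (1 / 2 - τ + ω) * whittakerM τ (-ω) z

open Classical in
/-- The Whittaker function `W_{τ,ω}`: the combination of `M_{τ,ω}` and `M_{τ,-ω}` if `2ω` is
not an integer, and, as usual, its limit in the second index if `2ω` is an integer. -/
def whittakerW (τ ω z : ℂ) : ℂ :=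
  if ∃ n : ℤ, 2 * ω = n then
    limUnder (𝓝[≠] ω) (fun s : ℂ => whittakerConnection τ s z)
  else whittakerConnection τ ω z

end

/-! Integrating the Struve series against `t^(ζ-1) e^{-t/2} W_{τ,ω}(t)` term by term reduces the
identity to the Mellin transform of `e^{-t/2} W_{τ,ω}(t)`, which is
`Γ(1/2+ω+s) Γ(1/2-ω+s) / Γ(1-τ+s)`.

For `Re (1/2+ω-τ) > 0` the Whittaker function is Tricomi's integral up to elementary factors (the
modified Wronskians of the three solutions of Kummer's equation involved are constants, read off
at `0`), and the Mellin transform follows from Fubini's theorem and Beta integrals. The three-term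
recurrence in `τ` carries both this formula and the bounds on `W_{τ,ω}` over to every `τ`.

The bounds give absolute moments of size `Γ(2k + σ)`, so that the interchange is legitimate as soon
as `Γ(2k + σ) / (Γ(λk) Γ(ak)) |cx/4|^k` is summable, which the ratio test decides. -/

open Set

/-! ### The regularized Kummer function -/

/-- The `n`-th term of the series of `kummerReg`. -/
noncomputable def kummerRegTerm (a c z : ℂ) (n : ℕ) : ℂ :=
  (ascPochhammer ℂ n).eval a * (Complex.Gamma (c + n))⁻¹ * (z ^ n / (n.factorial : ℂ))

/-- The regularized Kummer function `₁F₁(a; c; z) / Γ(c)`. Unlike `kummerF`, it is entire in `a`,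
`c` and `z`, the poles of `₁F₁` in `c` being cancelled by `1 / Γ(c)`. -/
noncomputable def kummerReg (a c z : ℂ) : ℂ :=
  ∑' n : ℕ, kummerRegTerm a c z n

theorem norm_ascPochhammer_eval_le {N : ℝ} (hN : 1 ≤ N) {a : ℂ} (ha : ‖a‖ ≤ N) (n : ℕ) :
    ‖(ascPochhammer ℂ n).eval a‖ ≤ N ^ n * (n.factorial : ℝ) := by
  induction n with
  | zero => simp
  | succ n ih =>
    have h_factor : ‖a + n‖ ≤ N * (n + 1) := by
      calc ‖a + n‖ ≤ ‖a‖ + ‖(n : ℂ)‖ := norm_add_le _ _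
        _ ≤ N + n := by rw [Complex.norm_natCast]; linarith
        _ ≤ N * (n + 1) := by nlinarith [(Nat.cast_nonneg n : (0 : ℝ) ≤ n)]
    rw [ascPochhammer_succ_eval, norm_mul]
    calc _ ≤ (N ^ n * (n.factorial : ℝ)) * (N * (n + 1)) := by gcongr
      _ = _ := by rw [Nat.factorial_succ]; push_cast; ring

theorem norm_inv_Gamma_add_nat_le {w : ℂ} (hw : 1 ≤ w.re) (m : ℕ) :
    ‖(Complex.Gamma (w + m))⁻¹‖ ≤ ‖(Complex.Gamma w)⁻¹‖ / (m.factorial : ℝ) := by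
  induction m with
  | zero => simp
  | succ m ih =>
    have h_factor : (m : ℝ) + 1 ≤ ‖w + m‖ := by
      calc (m : ℝ) + 1 ≤ (w + m).re := by simp only [Complex.add_re, Complex.natCast_re]; linarith
        _ ≤ ‖w + m‖ := Complex.re_le_norm _
    have h_rec : ((m : ℝ) + 1) * ‖(Complex.Gamma (w + (m + 1 : ℕ)))⁻¹‖ ≤
        ‖(Complex.Gamma (w + m))⁻¹‖ := by
      rw [Complex.one_div_Gamma_eq_self_mul_one_div_Gamma_add_one (w + m), norm_mul,
        Nat.cast_add_one, ← add_assoc]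
      gcongr
    rw [le_div_iff₀ (by positivity)] at ih ⊢
    calc _ = ((m : ℝ) + 1) * ‖(Complex.Gamma (w + (m + 1 : ℕ)))⁻¹‖ * m.factorial := by
          rw [Nat.factorial_succ]; push_cast; ring
      _ ≤ ‖(Complex.Gamma (w + m))⁻¹‖ * m.factorial := by gcongr
      _ ≤ _ := ih

theorem exists_norm_inv_Gamma_add_nat_le (N : ℕ) :
    ∃ K : ℝ, ∀ (c : ℂ) (n : ℕ), ‖c‖ + 1 ≤ N →
      ‖(Complex.Gamma (c + n))⁻¹‖ ≤ K / ((n - N).factorial : ℝ) := by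
  obtain ⟨K, hK⟩ := (isCompact_closedBall (0 : ℂ) (2 * N)).exists_bound_of_continuousOn
    Complex.differentiable_one_div_Gamma.continuous.continuousOn
  have h_initial : ∀ (c : ℂ) (n : ℕ), ‖c‖ + 1 ≤ N → n ≤ N →
      ‖(Complex.Gamma (c + n))⁻¹‖ ≤ K := by
    intro c n hc hn
    refine hK _ (mem_closedBall_zero_iff.2 ?_)
    have : (n : ℝ) ≤ N := mod_cast hn
    calc ‖c + n‖ ≤ ‖c‖ + ‖(n : ℂ)‖ := norm_add_le _ _
      _ ≤ 2 * N := by rw [Complex.norm_natCast]; linarith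
  refine ⟨K, fun c n hc => ?_⟩
  rcases le_total n N with hn | hn
  · simpa [Nat.sub_eq_zero_of_le hn] using h_initial c n hc hn
  · obtain ⟨m, rfl⟩ := Nat.exists_eq_add_of_le hn
    have h_re : 1 ≤ (c + N).re := by
      have := (abs_le.1 (Complex.abs_re_le_norm c)).1
      simp only [Complex.add_re, Complex.natCast_re]
      linarith
    rw [Nat.add_sub_cancel_left, Nat.cast_add, ← add_assoc]
    exact (norm_inv_Gamma_add_nat_le h_re m).trans (by gcongr; exact h_initial c N hc le_rfl)

theorem exists_summable_norm_kummerRegTerm_le (R : ℝ) :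
    ∃ u : ℕ → ℝ, Summable u ∧ ∀ (a c z : ℂ) (n : ℕ), ‖a‖ ≤ R → ‖c‖ ≤ R → ‖z‖ ≤ R →
      ‖kummerRegTerm a c z n‖ ≤ u n := by
  obtain ⟨N, hN⟩ := exists_nat_ge (max R 0 + 1)
  have hRN : R + 1 ≤ N := le_trans (by gcongr; exact le_max_left _ _) hN
  have hN_one : (1 : ℝ) ≤ N := le_trans (by simp) hN
  obtain ⟨K, hK⟩ := exists_norm_inv_Gamma_add_nat_le N
  have hK_nonneg : 0 ≤ K := by
    simpa using (norm_nonneg _).trans (hK 0 0 (by simpa using hN_one))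
  refine ⟨fun n => K * ((N : ℝ) ^ 2) ^ n / ((n - N).factorial : ℝ), ?_, ?_⟩
  · rw [← summable_nat_add_iff N]
    refine ((Real.summable_pow_div_factorial ((N : ℝ) ^ 2)).mul_left
      (K * ((N : ℝ) ^ 2) ^ N)).congr fun n => ?_
    rw [Nat.add_sub_cancel, pow_add]
    ring
  · intro a c z n ha hc hz
    rw [kummerRegTerm, norm_mul, norm_mul, norm_div, norm_pow, Complex.norm_natCast]
    calc _ ≤ ((N : ℝ) ^ n * (n.factorial : ℝ)) * (K / ((n - N).factorial : ℝ)) *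
          ((N : ℝ) ^ n / n.factorial) := by
          gcongr
          · exact norm_ascPochhammer_eval_le hN_one (by linarith) n
          · exact hK c n (by linarith)
          · linarith
      _ = K * ((N : ℝ) ^ 2) ^ n / ((n - N).factorial : ℝ) := by
        rw [← pow_mul, mul_comm 2 n, pow_mul]
        field_simp

theorem exists_summable_norm_kummerRegTerm_comp_le {f g h : ℂ → ℂ} (hf : Continuous f)
    (hg : Continuous g) (hh : Continuous h) (s₀ : ℂ) :
    ∃ u : ℕ → ℝ, Summable u ∧ ∀ n, ∀ s ∈ Metric.ball s₀ 1,
      ‖kummerRegTerm (f s) (g s) (h s) n‖ ≤ u n := by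
  have h_cpt := isCompact_closedBall s₀ 1
  obtain ⟨A, hA⟩ := h_cpt.exists_bound_of_continuousOn hf.continuousOn
  obtain ⟨B, hB⟩ := h_cpt.exists_bound_of_continuousOn hg.continuousOn
  obtain ⟨C, hC⟩ := h_cpt.exists_bound_of_continuousOn hh.continuousOn
  obtain ⟨u, hu, hb⟩ := exists_summable_norm_kummerRegTerm_le (max A (max B C))
  refine ⟨u, hu, fun n s hs => ?_⟩
  have hs' := Metric.ball_subset_closedBall hs
  exact hb _ _ _ n ((hA s hs').trans (by simp)) ((hB s hs').trans (by simp))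
    ((hC s hs').trans (by simp))

theorem differentiable_kummerRegTerm_comp {f g h : ℂ → ℂ} (hf : Differentiable ℂ f)
    (hg : Differentiable ℂ g) (hh : Differentiable ℂ h) (n : ℕ) :
    Differentiable ℂ fun s => kummerRegTerm (f s) (g s) (h s) n :=
  (((Polynomial.differentiable _).comp hf).mul
    (Complex.differentiable_one_div_Gamma.comp (hg.add_const _))).mul ((hh.pow n).div_const _)

theorem differentiable_kummerReg_comp {f g h : ℂ → ℂ} (hf : Differentiable ℂ f)
    (hg : Differentiable ℂ g) (hh : Differentiable ℂ h) :
    Differentiable ℂ fun s => kummerReg (f s) (g s) (h s) := by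
  intro s₀
  obtain ⟨u, hu, hb⟩ := exists_summable_norm_kummerRegTerm_comp_le hf.continuous hg.continuous
    hh.continuous s₀
  exact (Complex.differentiableOn_tsum_of_summable_norm hu
    (fun n => (differentiable_kummerRegTerm_comp hf hg hh n).differentiableOn)
    Metric.isOpen_ball hb).differentiableAt (Metric.ball_mem_nhds s₀ one_pos)

theorem hasSum_kummerReg (a c z : ℂ) : HasSum (kummerRegTerm a c z) (kummerReg a c z) := by
  obtain ⟨u, hu, hb⟩ := exists_summable_norm_kummerRegTerm_le (max ‖a‖ (max ‖c‖ ‖z‖))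
  exact (hu.of_norm_bounded fun n => hb a c z n (by simp) (by simp) (by simp)).hasSum

theorem kummerReg_zero (a c : ℂ) : kummerReg a c 0 = (Complex.Gamma c)⁻¹ := by
  rw [kummerReg, tsum_eq_single 0 fun n hn => by simp [kummerRegTerm, hn]]
  simp [kummerRegTerm]

theorem ascPochhammer_succ_eval_left (n : ℕ) (a : ℂ) :
    (ascPochhammer ℂ (n + 1)).eval a = a * (ascPochhammer ℂ n).eval (a + 1) := by
  simp [ascPochhammer_succ_left, Polynomial.eval_comp]

theorem deriv_kummerRegTerm_succ (a c z : ℂ) (n : ℕ) :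
    deriv (fun w => kummerRegTerm a c w (n + 1)) z = a * kummerRegTerm (a + 1) (c + 1) z n := by
  have h_shift : c + ((n + 1 : ℕ) : ℂ) = c + 1 + n := by push_cast; ring
  have h_succ : (n : ℂ) + 1 ≠ 0 := by exact_mod_cast n.succ_ne_zero
  have h_factorial : (n.factorial : ℂ) ≠ 0 := by exact_mod_cast n.factorial_ne_zero
  simp only [kummerRegTerm, ascPochhammer_succ_eval_left, h_shift, Nat.factorial_succ]
  rw [deriv_const_mul_field, deriv_div_const, deriv_pow_field, Nat.add_sub_cancel]
  push_cast
  field_simp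

theorem hasDerivAt_kummerReg (a c z : ℂ) :
    HasDerivAt (kummerReg a c) (a * kummerReg (a + 1) (c + 1) z) z := by
  obtain ⟨u, hu, hb⟩ := exists_summable_norm_kummerRegTerm_comp_le (f := fun _ => a)
    (g := fun _ => c) continuous_const continuous_const continuous_id z
  have h_deriv : HasSum (fun n => deriv (fun w => kummerRegTerm a c w n) z)
      (deriv (kummerReg a c) z) :=
    Complex.hasSum_deriv_of_summable_norm hu
      (fun n => (differentiable_kummerRegTerm_comp (differentiable_const a)
        (differentiable_const c) differentiable_id n).differentiableOn)
      Metric.isOpen_ball hb (Metric.mem_ball_self one_pos)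
  have h_shifted : HasSum (fun n => deriv (fun w => kummerRegTerm a c w (n + 1)) z)
      (a * kummerReg (a + 1) (c + 1) z) := by
    simpa only [deriv_kummerRegTerm_succ] using (hasSum_kummerReg (a + 1) (c + 1) z).mul_left a
  have h_eq := h_deriv.unique ((hasSum_nat_add_iff 1).1 h_shifted)
  rw [Finset.sum_range_one, show (fun w => kummerRegTerm a c w 0) = fun _ => (Complex.Gamma c)⁻¹
    from funext fun w => by simp [kummerRegTerm], deriv_const, add_zero] at h_eq
  rw [← h_eq]
  exact (differentiable_kummerReg_comp (differentiable_const a) (differentiable_const c)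
    differentiable_id z).hasDerivAt

theorem hasSum_mul_kummerReg (a c z : ℂ) :
    HasSum (fun n : ℕ => (n : ℂ) * (ascPochhammer ℂ (n - 1)).eval a *
      (Complex.Gamma (c + n - 1))⁻¹ * (z ^ n / (n.factorial : ℂ))) (z * kummerReg a c z) := by
  rw [← hasSum_nat_add_iff' 1]
  simp only [Finset.sum_range_one, Nat.cast_zero, zero_mul, sub_zero]
  refine ((hasSum_kummerReg a c z).mul_left z).congr_fun fun n => ?_
  have h_shift : c + ((n + 1 : ℕ) : ℂ) - 1 = c + n := by push_cast; ring
  have h_succ : (n : ℂ) + 1 ≠ 0 := by exact_mod_cast n.succ_ne_zero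
  have h_factorial : (n.factorial : ℂ) ≠ 0 := by exact_mod_cast n.factorial_ne_zero
  rw [h_shift, kummerRegTerm, Nat.factorial_succ, Nat.add_sub_cancel]
  push_cast
  field_simp
  ring

theorem kummerReg_add_one_left (a c z : ℂ) :
    kummerReg (a + 1) c z = kummerReg a c z + z * kummerReg (a + 1) (c + 1) z := by
  refine (hasSum_kummerReg (a + 1) c z).unique (((hasSum_kummerReg a c z).add
    (hasSum_mul_kummerReg (a + 1) (c + 1) z)).congr_fun fun n => ?_)
  have h_shift : c + 1 + n - 1 = c + (n : ℂ) := by ring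
  simp only [kummerRegTerm, h_shift]
  cases n with
  | zero => simp
  | succ n =>
    rw [Nat.add_sub_cancel, ascPochhammer_succ_eval_left n a, ascPochhammer_succ_eval n (a + 1)]
    push_cast
    ring

theorem kummerReg_sub_one_right (a c z : ℂ) :
    kummerReg a (c - 1) z = (c - 1) * kummerReg a c z + a * (z * kummerReg (a + 1) (c + 1) z) := by
  refine (hasSum_kummerReg a (c - 1) z).unique ((((hasSum_kummerReg a c z).mul_left (c - 1)).add
    ((hasSum_mul_kummerReg (a + 1) (c + 1) z).mul_left a)).congr_fun fun n => ?_)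
  have h_Gamma := Complex.one_div_Gamma_eq_self_mul_one_div_Gamma_add_one (c - 1 + n)
  have h_shift : c + 1 + n - 1 = c + (n : ℂ) := by ring
  have h_shift' : c - 1 + n + 1 = c + (n : ℂ) := by ring
  rw [h_shift'] at h_Gamma
  simp only [kummerRegTerm, h_shift, h_Gamma]
  cases n with
  | zero => simp
  | succ n =>
    rw [Nat.add_sub_cancel, ascPochhammer_succ_eval_left n a]
    push_cast
    ring

theorem kummerReg_ode (a c z : ℂ) :
    z * ((a + 1) * kummerReg (a + 2) (c + 2) z) =
      kummerReg a c z - (c - z) * kummerReg (a + 1) (c + 1) z := by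
  have h_lower := kummerReg_sub_one_right (a + 1) (c + 1) z
  rw [add_sub_cancel_right, add_assoc a, add_assoc c, one_add_one_eq_two] at h_lower
  linear_combination kummerReg_add_one_left a c z - h_lower

theorem kummerReg_three_term_right (a c z : ℂ) :
    kummerReg a (c - 2) z = (c - 2 + z) * kummerReg a (c - 1) z +
      (a - c + 1) * (z * kummerReg a c z) := by
  have h_lower := kummerReg_sub_one_right a (c - 1) z
  rw [sub_sub, one_add_one_eq_two, sub_add_cancel] at h_lower
  linear_combination h_lower - z * kummerReg_sub_one_right a c z +
    a * z * kummerReg_add_one_left a c z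

theorem kummerReg_contiguous (a c z : ℂ) :
    a * kummerReg (a + 1) c z =
      (c - a) * kummerReg (a - 1) c z + (2 * a - c + z) * kummerReg a c z := by
  have h_raise := kummerReg_add_one_left (a - 1) c z
  have h_lower := kummerReg_sub_one_right a (c + 1) z
  rw [sub_add_cancel] at h_raise
  rw [add_sub_cancel_right] at h_lower
  linear_combination (c - a) * h_raise + a * kummerReg_add_one_left a c z - z * h_lower +
    a * z * kummerReg_add_one_left a (c + 1) z

theorem kummerF_eq_Gamma_mul_kummerReg (a : ℂ) {c : ℂ} (hc : ∀ k : ℕ, c ≠ -k) (z : ℂ) :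
    kummerF a c z = Complex.Gamma c * kummerReg a c z := by
  rw [kummerF, kummerReg, ← tsum_mul_left]
  congr 1 with n
  have h_Gamma := Complex.Gamma_ne_zero hc
  rw [← Complex.Gamma_add_nat_div_Gamma_eq c hc, kummerRegTerm]
  field_simp

/-! ### Complex powers and integrals on the half line -/

theorem cpow_add_one {z : ℂ} (hz : z ≠ 0) (s : ℂ) : z ^ (s + 1) = z ^ s * z := by
  rw [Complex.cpow_add _ _ hz, Complex.cpow_one]

theorem one_div_ofReal_cpow {r : ℝ} (hr : 0 < r) (s : ℂ) :
    (1 / (r : ℂ)) ^ s = (r : ℂ) ^ (-s) := by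
  have h_arg : (r : ℂ).arg ≠ Real.pi := by
    rw [Complex.arg_ofReal_of_nonneg hr.le]
    exact Real.pi_ne_zero.symm
  rw [one_div, Complex.inv_cpow _ _ h_arg, Complex.cpow_neg]

theorem one_add_ofReal_ne_zero {u : ℝ} (hu : 0 < u) : (1 + u : ℂ) ≠ 0 :=
  mod_cast (by positivity : (1 + u : ℝ) ≠ 0)

theorem norm_one_add_ofReal_cpow {u : ℝ} (hu : 0 < u) (γ : ℂ) :
    ‖(1 + u : ℂ) ^ γ‖ = (1 + u) ^ γ.re := by
  rw [← Complex.norm_cpow_eq_rpow_re_of_pos (by positivity)]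
  push_cast
  rfl

theorem hasDerivAt_ofReal_cpow (s : ℂ) {t : ℝ} (ht : 0 < t) :
    HasDerivAt (fun u : ℝ => (u : ℂ) ^ s) (s * (t : ℂ) ^ (s - 1)) t := by
  simpa using ((hasDerivAt_id (t : ℂ)).cpow_const (c := s) (Or.inl (by simpa using ht))).comp_ofReal

theorem tendsto_ofReal_cpow_nhdsGT_zero {s : ℂ} (hs : 0 < s.re) :
    Tendsto (fun t : ℝ => (t : ℂ) ^ s) (𝓝[>] 0) (𝓝 0) := by
  have hs_ne : s ≠ 0 := by rintro rfl; simp at hs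
  have h := (Complex.continuous_ofReal_cpow_const hs).tendsto 0
  rw [Complex.ofReal_zero, Complex.zero_cpow hs_ne] at h
  exact h.mono_left nhdsWithin_le_nhds

theorem rpow_le_rpow_add_rpow {A B x t : ℝ} (ht : 0 < t) (hA : A ≤ x) (hB : x ≤ B) :
    t ^ x ≤ t ^ A + t ^ B := by
  rcases le_total t 1 with h | h
  · exact (Real.rpow_le_rpow_of_exponent_ge ht h hA).trans
      (le_add_of_nonneg_right (by positivity))
  · exact (Real.rpow_le_rpow_of_exponent_le h hB).trans
      (le_add_of_nonneg_left (by positivity))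

theorem exp_neg_le_mul_rpow_neg {δ y : ℝ} (hδ : 0 < δ) (hy : 0 < y) :
    Real.exp (-y) ≤ δ ^ δ * y ^ (-δ) := by
  have h : y ^ δ ≤ δ ^ δ * Real.exp y := by
    calc y ^ δ = δ ^ δ * (y / δ) ^ δ := by
          rw [← Real.mul_rpow hδ.le (by positivity), mul_div_cancel₀ _ hδ.ne']
      _ ≤ δ ^ δ * Real.exp (y / δ) ^ δ := by
          gcongr
          exact (le_add_of_nonneg_right zero_le_one).trans (Real.add_one_le_exp _)
      _ = δ ^ δ * Real.exp y := by rw [← Real.exp_mul, div_mul_cancel₀ _ hδ.ne']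
  rw [Real.exp_neg, Real.rpow_neg hy.le, ← div_eq_mul_inv, le_div_iff₀ (by positivity),
    inv_mul_le_iff₀ (Real.exp_pos y)]
  linarith

theorem integrableOn_rpow_mul_exp_neg {s r : ℝ} (hs : 0 < s) (hr : 0 < r) :
    IntegrableOn (fun x : ℝ => x ^ (s - 1) * Real.exp (-(r * x))) (Ioi 0) := by
  simpa using integrableOn_rpow_mul_exp_neg_mul_rpow (s := s - 1) (by linarith) one_pos hr

theorem integrableOn_cpow_mul_exp_neg {s : ℂ} {r : ℝ} (hs : 0 < s.re) (hr : 0 < r) :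
    IntegrableOn (fun x : ℝ => (x : ℂ) ^ (s - 1) * Complex.exp (-(r * x))) (Ioi 0) := by
  refine (integrableOn_rpow_mul_exp_neg hs hr).mono' (by fun_prop) ?_
  filter_upwards [ae_restrict_mem measurableSet_Ioi] with x hx
  rw [norm_mul, Complex.norm_cpow_eq_rpow_re_of_pos hx, Complex.norm_exp]
  simp

theorem integral_cpow_mul_exp_neg {s : ℂ} {r : ℝ} (hs : 0 < s.re) (hr : 0 < r) :
    ∫ x in Ioi (0 : ℝ), (x : ℂ) ^ (s - 1) * Complex.exp (-(r * x)) =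
      (r : ℂ) ^ (-s) * Complex.Gamma s := by
  rw [Complex.integral_cpow_mul_exp_neg_mul_Ioi hs hr, one_div_ofReal_cpow hr]

theorem integral_cpow_mul_exp_neg_one {s : ℂ} (hs : 0 < s.re) :
    ∫ x in Ioi (0 : ℝ), (x : ℂ) ^ (s - 1) * Complex.exp (-x) = Complex.Gamma s := by
  simpa using integral_cpow_mul_exp_neg hs one_pos

theorem integrableOn_rpow_mul_one_add_rpow {a b : ℝ} (ha : 0 < a) (hb : 0 < b) :
    IntegrableOn (fun u : ℝ => u ^ (a - 1) * (1 + u) ^ (-(a + b))) (Ioi 0) := by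
  rw [← Ioc_union_Ioi_eq_Ioi zero_le_one]
  refine IntegrableOn.union ?_ ?_
  · have h_int : IntegrableOn (fun u : ℝ => u ^ (a - 1)) (Ioc 0 1) :=
      (intervalIntegrable_iff_integrableOn_Ioc_of_le zero_le_one).1
        (intervalIntegral.intervalIntegrable_rpow' (by linarith))
    refine h_int.mono' (by fun_prop) ?_
    filter_upwards [ae_restrict_mem measurableSet_Ioc] with u hu
    have hu_pos := hu.1
    rw [Real.norm_of_nonneg (by positivity)]
    exact mul_le_of_le_one_right (by positivity)
      (Real.rpow_le_one_of_one_le_of_nonpos (by linarith) (by linarith))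
  · refine (integrableOn_Ioi_rpow_of_lt (a := -b - 1) (by linarith) one_pos).mono'
      (by fun_prop) ?_
    filter_upwards [ae_restrict_mem measurableSet_Ioi] with u hu
    have hu_pos : 0 < u := one_pos.trans hu
    rw [Real.norm_of_nonneg (by positivity)]
    calc u ^ (a - 1) * (1 + u) ^ (-(a + b)) ≤ u ^ (a - 1) * u ^ (-(a + b)) := by
          gcongr u ^ (a - 1) * ?_
          exact Real.rpow_le_rpow_of_nonpos hu_pos (by linarith) (by linarith)
      _ = u ^ (-b - 1) := by rw [← Real.rpow_add hu_pos]; ring_nf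

theorem integrableOn_cpow_mul_one_add_cpow {a b : ℂ} (ha : 0 < a.re) (hb : 0 < b.re) :
    IntegrableOn (fun u : ℝ => (u : ℂ) ^ (a - 1) * (1 + u : ℂ) ^ (-(a + b))) (Ioi 0) := by
  refine (integrableOn_rpow_mul_one_add_rpow ha hb).mono' (by fun_prop) ?_
  filter_upwards [ae_restrict_mem measurableSet_Ioi] with u hu
  rw [norm_mul, Complex.norm_cpow_eq_rpow_re_of_pos hu, norm_one_add_ofReal_cpow hu]
  simp

theorem integral_norm_cpow_mul_exp_mul_laplaceKernel {s g : ℂ} {u : ℝ} (hs : 0 < s.re)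
    (hu : 0 < u) :
    ∫ t in Ioi (0 : ℝ), ‖(t : ℂ) ^ (s - 1) * Complex.exp (-t) * (g * Complex.exp (-(t * u)))‖ =
      Real.Gamma s.re * ‖g * (1 + u : ℂ) ^ (-s)‖ := by
  have hu_add : 0 < 1 + u := by positivity
  have h_norm : ∀ t ∈ Ioi (0 : ℝ),
      ‖(t : ℂ) ^ (s - 1) * Complex.exp (-t) * (g * Complex.exp (-(t * u)))‖ =
        ‖g‖ * (t ^ (s.re - 1) * Real.exp (-((1 + u) * t))) := by
    intro t ht
    have h_exp : Real.exp (-((1 + u) * t)) = Real.exp (-t) * Real.exp (-(t * u)) := by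
      rw [← Real.exp_add]
      ring_nf
    simp only [norm_mul, Complex.norm_cpow_eq_rpow_re_of_pos ht, Complex.norm_exp, h_exp,
      Complex.sub_re, Complex.one_re, Complex.neg_re, Complex.ofReal_re, Complex.re_mul_ofReal]
    ring
  rw [setIntegral_congr_fun measurableSet_Ioi h_norm, integral_const_mul,
    Real.integral_rpow_mul_exp_neg_mul_Ioi hs hu_add, norm_mul, norm_one_add_ofReal_cpow hu,
    Complex.neg_re, one_div, Real.inv_rpow hu_add.le, Real.rpow_neg hu_add.le]
  ring

theorem integral_cpow_mul_exp_mul_laplaceKernel {s g : ℂ} {u : ℝ} (hs : 0 < s.re) (hu : 0 < u) :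
    ∫ t in Ioi (0 : ℝ), (t : ℂ) ^ (s - 1) * Complex.exp (-t) * (g * Complex.exp (-(t * u))) =
      Complex.Gamma s * (g * (1 + u : ℂ) ^ (-s)) := by
  have h_combine : ∀ t : ℝ, (t : ℂ) ^ (s - 1) * Complex.exp (-t) * (g * Complex.exp (-(t * u))) =
      g * ((t : ℂ) ^ (s - 1) * Complex.exp (-((1 + u : ℝ) * t))) := by
    intro t
    have h_exp : Complex.exp (-((1 + u : ℝ) * t)) = Complex.exp (-t) * Complex.exp (-(t * u)) := by
      rw [← Complex.exp_add]
      push_cast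
      ring_nf
    rw [h_exp]
    ring
  simp only [h_combine]
  rw [integral_const_mul, integral_cpow_mul_exp_neg hs (by positivity)]
  push_cast
  ring

theorem integral_cpow_mul_exp_neg_mul_laplace {g : ℝ → ℂ} {s : ℂ} (hg : Measurable g)
    (hs : 0 < s.re) (h_int : IntegrableOn (fun u : ℝ => g u * (1 + u : ℂ) ^ (-s)) (Ioi 0)) :
    ∫ t in Ioi (0 : ℝ), (t : ℂ) ^ (s - 1) * Complex.exp (-t) *
        ∫ u in Ioi (0 : ℝ), g u * Complex.exp (-(t * u)) =
      Complex.Gamma s * ∫ u in Ioi (0 : ℝ), g u * (1 + u : ℂ) ^ (-s) := by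
  let F : ℝ → ℝ → ℂ := fun t u =>
    (t : ℂ) ^ (s - 1) * Complex.exp (-t) * (g u * Complex.exp (-(t * u)))
  have hF_meas : Measurable (Function.uncurry F) := by
    unfold F Function.uncurry
    fun_prop
  have hF : Integrable (Function.uncurry F)
      ((volume.restrict (Ioi 0)).prod (volume.restrict (Ioi 0))) := by
    rw [integrable_prod_iff' hF_meas.aestronglyMeasurable]
    constructor
    · filter_upwards [ae_restrict_mem measurableSet_Ioi] with u hu
      refine ((integrableOn_cpow_mul_exp_neg hs one_pos).norm.const_mul ‖g u‖).mono'
        (hF_meas.comp (by fun_prop)).aestronglyMeasurable ?_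
      filter_upwards [ae_restrict_mem measurableSet_Ioi] with t ht
      have h_exp : ‖Complex.exp (-(t * u))‖ ≤ 1 := by
        rw [Complex.norm_exp, Real.exp_le_one_iff]
        simpa using mul_nonneg (le_of_lt ht) (le_of_lt hu)
      simp only [Function.uncurry, F, norm_mul, Complex.ofReal_one, one_mul]
      rw [mul_left_comm, ← mul_assoc]
      exact mul_le_of_le_one_right (by positivity) h_exp
    · refine (h_int.norm.const_mul (Real.Gamma s.re)).congr ?_
      filter_upwards [ae_restrict_mem measurableSet_Ioi] with u hu
      exact (integral_norm_cpow_mul_exp_mul_laplaceKernel hs hu).symm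
  simp only [← integral_const_mul]
  rw [integral_integral_swap hF]
  exact setIntegral_congr_fun measurableSet_Ioi fun u hu =>
    integral_cpow_mul_exp_mul_laplaceKernel hs hu

theorem integral_cpow_mul_one_add_cpow {a b : ℂ} (ha : 0 < a.re) (hb : 0 < b.re) :
    ∫ u in Ioi (0 : ℝ), (u : ℂ) ^ (a - 1) * (1 + u : ℂ) ^ (-(a + b)) =
      Complex.Gamma a * Complex.Gamma b / Complex.Gamma (a + b) := by
  have hab : 0 < (a + b).re := by rw [Complex.add_re]; positivity
  rw [eq_div_iff (Complex.Gamma_ne_zero_of_re_pos hab), mul_comm,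
    ← integral_cpow_mul_exp_neg_mul_laplace (by fun_prop) hab
      (integrableOn_cpow_mul_one_add_cpow ha hb),
    ← integral_cpow_mul_exp_neg_one hb, ← integral_const_mul]
  refine setIntegral_congr_fun measurableSet_Ioi fun t ht => ?_
  have ht_ne : (t : ℂ) ≠ 0 := mod_cast (ne_of_gt ht)
  rw [integral_cpow_mul_exp_neg ha ht, show b - 1 = (a + b - 1) + -a by ring,
    Complex.cpow_add _ _ ht_ne]
  ring

/-! ### Tricomi's integral -/

/-- The integrand of `tricomiIntegral`. -/
noncomputable def tricomiIntegrand (α γ : ℂ) (t u : ℝ) : ℂ :=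
  (u : ℂ) ^ (α - 1) * (1 + u : ℂ) ^ γ * Complex.exp (-(t * u))

/-- Tricomi's integral `∫₀^∞ u^(α-1) (1+u)^γ e^(-tu) du`, which is `Γ(α) U(α, α+γ+1, t)` for
Tricomi's confluent hypergeometric function `U`. -/
noncomputable def tricomiIntegral (α γ : ℂ) (t : ℝ) : ℂ :=
  ∫ u in Ioi (0 : ℝ), tricomiIntegrand α γ t u

/-- The absolute value of `tricomiIntegrand` for real exponents `a - 1` and `g`. -/
noncomputable def tricomiMajorant (a g t u : ℝ) : ℝ :=
  u ^ (a - 1) * (1 + u) ^ g * Real.exp (-(t * u))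

theorem norm_tricomiIntegrand {u : ℝ} (hu : 0 < u) (α γ : ℂ) (t : ℝ) :
    ‖tricomiIntegrand α γ t u‖ = tricomiMajorant α.re γ.re t u := by
  rw [tricomiIntegrand, tricomiMajorant, norm_mul, norm_mul, norm_one_add_ofReal_cpow hu,
    Complex.norm_cpow_eq_rpow_re_of_pos hu, Complex.norm_exp]
  simp

theorem measurable_tricomiIntegrand (α γ : ℂ) (t : ℝ) : Measurable (tricomiIntegrand α γ t) := by
  unfold tricomiIntegrand
  fun_prop

theorem tricomiMajorant_le {δ t u : ℝ} (hδ : 0 < δ) (ht : 0 < t) (hu : 0 < u) (a g : ℝ) :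
    tricomiMajorant a g t u ≤
      Real.exp 1 * δ ^ δ * (t ^ (-δ) + 1) * (u ^ (a - 1) * (1 + u) ^ (-(a + (δ - a - g)))) := by
  have h_exp : ∀ r : ℝ, 0 < r → r ≤ 1 →
      Real.exp (-(r * u)) ≤ Real.exp 1 * δ ^ δ * r ^ (-δ) * (1 + u) ^ (-δ) := by
    intro r hr hr_one
    calc Real.exp (-(r * u)) = Real.exp r * Real.exp (-(r * (1 + u))) := by
          rw [← Real.exp_add]
          ring_nf
      _ ≤ Real.exp 1 * (δ ^ δ * (r * (1 + u)) ^ (-δ)) := by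
          gcongr
          exact exp_neg_le_mul_rpow_neg hδ (by positivity)
      _ = _ := by
          rw [Real.mul_rpow hr.le (by positivity)]
          ring
  have h_t : Real.exp (-(t * u)) ≤ Real.exp 1 * δ ^ δ * (t ^ (-δ) + 1) * (1 + u) ^ (-δ) := by
    rcases le_total t 1 with h | h
    · refine (h_exp t ht h).trans ?_
      gcongr
      exact le_add_of_nonneg_right zero_le_one
    · calc Real.exp (-(t * u)) ≤ Real.exp (-(1 * u)) := by gcongr
        _ ≤ Real.exp 1 * δ ^ δ * 1 ^ (-δ) * (1 + u) ^ (-δ) := h_exp 1 one_pos le_rfl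
        _ ≤ _ := by
          rw [Real.one_rpow]
          gcongr
          exact le_add_of_nonneg_left (by positivity)
  calc tricomiMajorant a g t u
      ≤ u ^ (a - 1) * (1 + u) ^ g *
        (Real.exp 1 * δ ^ δ * (t ^ (-δ) + 1) * (1 + u) ^ (-δ)) := by
        unfold tricomiMajorant
        gcongr
    _ = Real.exp 1 * δ ^ δ * (t ^ (-δ) + 1) *
        (u ^ (a - 1) * ((1 + u) ^ g * (1 + u) ^ (-δ))) := by ring
    _ = _ := by
        rw [← Real.rpow_add (by positivity)]
        ring_nf

theorem integrableOn_tricomiMajorant {a t : ℝ} (ha : 0 < a) (g : ℝ) (ht : 0 < t) :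
    IntegrableOn (tricomiMajorant a g t) (Ioi 0) := by
  obtain ⟨δ, hδ⟩ := exists_gt (max 0 (a + g))
  obtain ⟨hδ_pos, hδ_gt⟩ := max_lt_iff.1 hδ
  refine ((integrableOn_rpow_mul_one_add_rpow ha (by linarith : 0 < δ - a - g)).const_mul
    (Real.exp 1 * δ ^ δ * (t ^ (-δ) + 1))).mono' ?_ ?_
  · unfold tricomiMajorant
    fun_prop
  · filter_upwards [ae_restrict_mem measurableSet_Ioi] with u hu
    have hu_pos : 0 < u := hu
    rw [Real.norm_of_nonneg (by unfold tricomiMajorant; positivity)]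
    exact tricomiMajorant_le hδ_pos ht hu a g

theorem integrableOn_tricomiIntegrand {α : ℂ} (hα : 0 < α.re) (γ : ℂ) {t : ℝ} (ht : 0 < t) :
    IntegrableOn (tricomiIntegrand α γ t) (Ioi 0) := by
  refine (integrableOn_tricomiMajorant hα γ.re ht).mono'
    (measurable_tricomiIntegrand α γ t).aestronglyMeasurable ?_
  filter_upwards [ae_restrict_mem measurableSet_Ioi] with u hu
  rw [norm_tricomiIntegrand hu]

theorem exists_norm_tricomiIntegral_le {α γ : ℂ} {δ : ℝ} (hα : 0 < α.re) (hδ : 0 < δ)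
    (hδ_gt : (α + γ).re < δ) :
    ∃ C : ℝ, 0 ≤ C ∧ ∀ t : ℝ, 0 < t → ‖tricomiIntegral α γ t‖ ≤ C * (t ^ (-δ) + 1) := by
  rw [Complex.add_re] at hδ_gt
  have h_int := integrableOn_rpow_mul_one_add_rpow hα (by linarith : 0 < δ - α.re - γ.re)
  refine ⟨Real.exp 1 * δ ^ δ *
    ∫ u in Ioi (0 : ℝ), u ^ (α.re - 1) * (1 + u) ^ (-(α.re + (δ - α.re - γ.re))), ?_, ?_⟩
  · refine mul_nonneg (by positivity) (setIntegral_nonneg measurableSet_Ioi fun u hu => ?_)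
    have hu_pos : 0 < u := hu
    positivity
  · intro t ht
    rw [mul_right_comm, ← integral_const_mul]
    refine norm_integral_le_of_norm_le (h_int.const_mul _) ?_
    filter_upwards [ae_restrict_mem measurableSet_Ioi] with u hu
    exact (norm_tricomiIntegrand hu α γ t).trans_le (tricomiMajorant_le hδ ht hu α.re γ.re)

theorem continuousAt_tricomiIntegral {f g : ℂ → ℂ} {s₀ : ℂ} (hf : ContinuousAt f s₀)
    (hg : ContinuousAt g s₀) (hf_re : 0 < (f s₀).re) {t : ℝ} (ht : 0 < t) :
    ContinuousAt (fun s => tricomiIntegral (f s) (g s) t) s₀ := by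
  have hf_cont : ContinuousAt (fun s => (f s).re) s₀ := Complex.continuous_re.continuousAt.comp hf
  have hg_cont : ContinuousAt (fun s => (g s).re) s₀ := Complex.continuous_re.continuousAt.comp hg
  refine continuousAt_of_dominated
    (Eventually.of_forall fun s => (measurable_tricomiIntegrand _ _ t).aestronglyMeasurable) ?_
    ((integrableOn_tricomiMajorant (half_pos hf_re) ((g s₀).re + 1) ht).add
      (integrableOn_tricomiMajorant (add_pos hf_re one_pos) ((g s₀).re + 1) ht)) ?_
  · filter_upwards [hf_cont.eventually_const_lt (half_lt_self hf_re),
      hf_cont.eventually_lt_const (lt_add_one _), hg_cont.eventually_lt_const (lt_add_one _)]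
      with s h_lower h_upper h_exponent
    filter_upwards [ae_restrict_mem measurableSet_Ioi] with u hu
    have hu_pos : 0 < u := hu
    rw [norm_tricomiIntegrand hu]
    simp only [Pi.add_apply, tricomiMajorant]
    rw [← add_mul, ← add_mul]
    gcongr ?_ * ?_ * _
    · exact rpow_le_rpow_add_rpow hu (by linarith) (by linarith)
    · exact Real.rpow_le_rpow_of_exponent_le (by linarith) h_exponent.le
  · filter_upwards [ae_restrict_mem measurableSet_Ioi] with u hu
    have hu_ne : (u : ℂ) ≠ 0 := mod_cast (ne_of_gt hu)
    exact (((hf.sub continuousAt_const).const_cpow (Or.inl hu_ne)).mul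
      (hg.const_cpow (Or.inl (one_add_ofReal_ne_zero hu)))).mul continuousAt_const

theorem norm_log_one_add_ofReal_le {u : ℝ} (hu : 0 < u) : ‖Complex.log (1 + u)‖ ≤ 1 + u := by
  rw [show (1 + u : ℂ) = ((1 + u : ℝ) : ℂ) by push_cast; rfl, ← Complex.ofReal_log (by positivity),
    Complex.norm_real, Real.norm_of_nonneg (Real.log_nonneg (by linarith))]
  exact (Real.log_le_sub_one_of_pos (by positivity)).trans (by linarith)

theorem differentiable_tricomiIntegral {α : ℂ} (hα : 0 < α.re) {t : ℝ} (ht : 0 < t) :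
    Differentiable ℂ fun γ => tricomiIntegral α γ t := by
  intro γ₀
  refine (hasDerivAt_integral_of_dominated_loc_of_deriv_le (μ := volume.restrict (Ioi 0))
    (F := fun γ u => tricomiIntegrand α γ t u)
    (F' := fun γ u => tricomiIntegrand α γ t u * Complex.log (1 + u))
    (Metric.ball_mem_nhds γ₀ one_pos)
    (Eventually.of_forall fun s => (measurable_tricomiIntegrand _ _ t).aestronglyMeasurable)
    (integrableOn_tricomiIntegrand hα γ₀ ht)
    ((measurable_tricomiIntegrand _ _ t).mul (by fun_prop)).aestronglyMeasurable ?_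
    (integrableOn_tricomiMajorant hα (γ₀.re + 1 + 1) ht) ?_).2.differentiableAt
  · filter_upwards [ae_restrict_mem measurableSet_Ioi] with u hu γ hγ
    have hu_pos : 0 < u := hu
    have h_re : γ.re ≤ γ₀.re + 1 := by
      have := (Complex.re_le_norm (γ - γ₀)).trans (mem_ball_iff_norm.1 hγ).le
      rw [Complex.sub_re] at this
      linarith
    rw [norm_mul, norm_tricomiIntegrand hu]
    unfold tricomiMajorant
    calc _ ≤ u ^ (α.re - 1) * (1 + u) ^ (γ₀.re + 1) * Real.exp (-(t * u)) * (1 + u) := by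
          gcongr
          · linarith
          · exact norm_log_one_add_ofReal_le hu
      _ = _ := by
        rw [Real.rpow_add_one (by positivity : 1 + u ≠ 0) (γ₀.re + 1)]
        ring
  · filter_upwards [ae_restrict_mem measurableSet_Ioi] with u hu γ _
    refine ((((hasDerivAt_id γ).const_cpow (c := (1 + u : ℂ))
      (Or.inl (one_add_ofReal_ne_zero hu))).const_mul ((u : ℂ) ^ (α - 1))).mul_const
      (Complex.exp (-(t * u)))).congr_deriv ?_
    simp only [id, tricomiIntegrand]
    ring

theorem mul_tricomiIntegrand {u : ℝ} (hu : 0 < u) (α γ : ℂ) (t : ℝ) :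
    (u : ℂ) * tricomiIntegrand α γ t u = tricomiIntegrand (α + 1) γ t u := by
  have hu_ne : (u : ℂ) ≠ 0 := mod_cast hu.ne'
  rw [tricomiIntegrand, tricomiIntegrand, show α + 1 - 1 = α - 1 + 1 by ring, cpow_add_one hu_ne]
  ring

theorem hasDerivAt_tricomiIntegral {α : ℂ} (hα : 0 < α.re) (γ : ℂ) {t : ℝ} (ht : 0 < t) :
    HasDerivAt (tricomiIntegral α γ) (-tricomiIntegral (α + 1) γ t) t := by
  unfold tricomiIntegral
  rw [← integral_neg]
  refine (hasDerivAt_integral_of_dominated_loc_of_deriv_le (μ := volume.restrict (Ioi 0))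
    (F := fun t u => tricomiIntegrand α γ t u)
    (F' := fun t u => -tricomiIntegrand (α + 1) γ t u)
    (Ioi_mem_nhds (half_lt_self ht))
    (Eventually.of_forall fun s => (measurable_tricomiIntegrand _ _ _).aestronglyMeasurable)
    (integrableOn_tricomiIntegrand hα γ ht)
    (measurable_tricomiIntegrand _ _ t).neg.aestronglyMeasurable ?_
    (integrableOn_tricomiMajorant (a := α.re + 1) (by positivity) γ.re (half_pos ht)) ?_).2
  · filter_upwards [ae_restrict_mem measurableSet_Ioi] with u hu s hs
    have hu_pos : 0 < u := hu
    have hs_gt : t / 2 < s := hs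
    rw [norm_neg, norm_tricomiIntegrand hu, Complex.add_re, Complex.one_re]
    unfold tricomiMajorant
    gcongr
  · filter_upwards [ae_restrict_mem measurableSet_Ioi] with u hu s _
    have h_exp : HasDerivAt (fun s : ℝ => Complex.exp (-(s * u)))
        (Complex.exp (-(s * u)) * -(1 * u)) s :=
      ((((hasDerivAt_id (s : ℂ)).mul_const (u : ℂ)).neg).cexp).comp_ofReal
    refine (h_exp.const_mul ((u : ℂ) ^ (α - 1) * (1 + u : ℂ) ^ γ)).congr_deriv ?_
    rw [← mul_tricomiIntegrand hu, tricomiIntegrand]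
    ring

theorem hasDerivAt_tricomiIntegrand (α γ : ℂ) (t : ℝ) {u : ℝ} (hu : 0 < u) :
    HasDerivAt (tricomiIntegrand (α + 1) (γ + 1) t)
      (-(t : ℂ) * tricomiIntegrand (α + 2) γ t u +
        (α + γ + 1 - t) * tricomiIntegrand (α + 1) γ t u + α * tricomiIntegrand α γ t u) u := by
  have h_pow := hasDerivAt_ofReal_cpow α hu
  have h_one_add : HasDerivAt (fun u : ℝ => (1 + u : ℂ) ^ (γ + 1))
      ((γ + 1) * (1 + u : ℂ) ^ γ) u := by
    simpa using (((hasDerivAt_id (u : ℂ)).const_add 1).cpow_const (c := γ + 1)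
      (Or.inl (by simp only [id, Complex.add_re, Complex.one_re, Complex.ofReal_re]
                  positivity))).comp_ofReal
  have h_exp : HasDerivAt (fun u : ℝ => Complex.exp (-(t * u)))
      (Complex.exp (-(t * u)) * -(t * 1)) u :=
    ((((hasDerivAt_id (u : ℂ)).const_mul (t : ℂ)).neg).cexp).comp_ofReal
  rw [show α + 2 = α + 1 + 1 by ring, ← mul_tricomiIntegrand hu (α + 1),
    ← mul_tricomiIntegrand hu α]
  unfold tricomiIntegrand
  rw [add_sub_cancel_right]
  refine ((h_pow.mul h_one_add).mul h_exp).congr_deriv ?_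
  have hu_ne : (u : ℂ) ≠ 0 := mod_cast hu.ne'
  have h_pow_succ : (u : ℂ) ^ α = (u : ℂ) ^ (α - 1) * u := by
    rw [← cpow_add_one hu_ne, sub_add_cancel]
  simp only [Pi.mul_apply, h_pow_succ, cpow_add_one (one_add_ofReal_ne_zero hu)]
  ring

theorem continuousAt_tricomiIntegrand_zero {α : ℂ} (hα : 0 < α.re) (γ : ℂ) (t : ℝ) :
    ContinuousAt (tricomiIntegrand (α + 1) γ t) 0 := by
  unfold tricomiIntegrand
  refine (ContinuousAt.mul ?_ ?_).mul (by fun_prop)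
  · rw [add_sub_cancel_right]
    exact (Complex.continuous_ofReal_cpow_const hα).continuousAt
  · exact ContinuousAt.cpow (by fun_prop) continuousAt_const (by simp)

theorem tricomiIntegral_ode {α : ℂ} (hα : 0 < α.re) (γ : ℂ) {t : ℝ} (ht : 0 < t) :
    t * tricomiIntegral (α + 2) γ t =
      (α + γ + 1 - t) * tricomiIntegral (α + 1) γ t + α * tricomiIntegral α γ t := by
  have hα_one : 0 < (α + 1).re := by
    rw [Complex.add_re, Complex.one_re]
    positivity
  have hα_two : 0 < (α + 2).re := by
    rw [Complex.add_re, Complex.re_ofNat]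
    positivity
  have hα_ne : α ≠ 0 := by rintro rfl; simp at hα
  have h_int₀ := (integrableOn_tricomiIntegrand hα γ ht).const_mul α
  have h_int₁ := (integrableOn_tricomiIntegrand hα_one γ ht).const_mul (α + γ + 1 - t)
  have h_int₂ := (integrableOn_tricomiIntegrand hα_two γ ht).const_mul (-(t : ℂ))
  have h_deriv := fun u (hu : u ∈ Ioi (0 : ℝ)) => hasDerivAt_tricomiIntegrand α γ t hu
  have h_int : IntegrableOn (fun u => -(t : ℂ) * tricomiIntegrand (α + 2) γ t u +
      (α + γ + 1 - t) * tricomiIntegrand (α + 1) γ t u + α * tricomiIntegrand α γ t u)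
      (Ioi 0) := (h_int₂.add h_int₁).add h_int₀
  have h_ftc := integral_Ioi_of_hasDerivAt_of_tendsto
    (continuousAt_tricomiIntegrand_zero hα (γ + 1) t).continuousWithinAt h_deriv h_int
    (tendsto_zero_of_hasDerivAt_of_integrableOn_Ioi h_deriv h_int
      (integrableOn_tricomiIntegrand hα_one (γ + 1) ht))
  have h_zero : tricomiIntegrand (α + 1) (γ + 1) t 0 = 0 := by simp [tricomiIntegrand, hα_ne]
  have h_split : ∫ u in Ioi (0 : ℝ), (-(t : ℂ) * tricomiIntegrand (α + 2) γ t u +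
      (α + γ + 1 - t) * tricomiIntegrand (α + 1) γ t u + α * tricomiIntegrand α γ t u) =
      -(t : ℂ) * tricomiIntegral (α + 2) γ t +
        (α + γ + 1 - t) * tricomiIntegral (α + 1) γ t + α * tricomiIntegral α γ t := by
    have h_int₂₁ : IntegrableOn (fun u => -(t : ℂ) * tricomiIntegrand (α + 2) γ t u +
        (α + γ + 1 - t) * tricomiIntegrand (α + 1) γ t u) (Ioi 0) := h_int₂.add h_int₁
    rw [integral_add h_int₂₁ h_int₀, integral_add h_int₂ h_int₁, integral_const_mul,
      integral_const_mul, integral_const_mul, tricomiIntegral, tricomiIntegral, tricomiIntegral]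
  rw [h_split, h_zero] at h_ftc
  linear_combination -h_ftc

theorem tendsto_tricomiIntegral_nhdsGT_zero {α γ : ℂ} (hα : 0 < α.re) (hαγ : (α + γ).re < 0) :
    Tendsto (tricomiIntegral α γ) (𝓝[>] 0)
      (𝓝 (Complex.Gamma α * Complex.Gamma (-(α + γ)) / Complex.Gamma (-γ))) := by
  have h_re : 0 < (-(α + γ)).re := by
    rw [Complex.neg_re]
    linarith
  have h_exponent : -(α + -(α + γ)) = γ := by ring
  have h_int := integrableOn_cpow_mul_one_add_cpow hα h_re
  have h_beta := integral_cpow_mul_one_add_cpow hα h_re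
  rw [h_exponent] at h_int h_beta
  rw [show -γ = α + -(α + γ) by ring, ← h_beta]
  refine tendsto_integral_filter_of_dominated_convergence _
    (Eventually.of_forall fun t => (measurable_tricomiIntegrand _ _ t).aestronglyMeasurable)
    ?_ h_int.norm ?_
  · filter_upwards [self_mem_nhdsWithin] with t ht
    filter_upwards [ae_restrict_mem measurableSet_Ioi] with u hu
    rw [tricomiIntegrand, norm_mul]
    refine mul_le_of_le_one_right (norm_nonneg _) ?_
    rw [Complex.norm_exp, Real.exp_le_one_iff]
    simpa using mul_nonneg (le_of_lt ht) (le_of_lt hu)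
  · filter_upwards with u
    have h_cont : ContinuousAt (fun t : ℝ => tricomiIntegrand α γ t u) 0 := by
      unfold tricomiIntegrand
      fun_prop
    have h_lim := h_cont.tendsto
    simp only [tricomiIntegrand, Complex.ofReal_zero, zero_mul, neg_zero, Complex.exp_zero,
      mul_one] at h_lim
    exact h_lim.mono_left nhdsWithin_le_nhds

theorem cpow_mul_tricomiIntegral {t : ℝ} (ht : 0 < t) (α γ : ℂ) :
    (t : ℂ) ^ (α + γ) * tricomiIntegral α γ t =
      ∫ v in Ioi (0 : ℝ), (v : ℂ) ^ (α - 1) * ((t + v : ℝ) : ℂ) ^ γ * Complex.exp (-v) := by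
  have ht_ne : (t : ℂ) ≠ 0 := mod_cast ht.ne'
  have h_scale : ∀ u ∈ Ioi (0 : ℝ), ((t * u : ℝ) : ℂ) ^ (α - 1) * ((t + t * u : ℝ) : ℂ) ^ γ *
      Complex.exp (-(t * u : ℝ)) = (t : ℂ) ^ (α + γ - 1) * tricomiIntegrand α γ t u := by
    intro u hu
    have hu_pos : 0 < u := hu
    rw [show t + t * u = t * (1 + u) by ring, Complex.ofReal_mul, Complex.ofReal_mul,
      Complex.mul_cpow_ofReal_nonneg ht.le hu_pos.le,
      Complex.mul_cpow_ofReal_nonneg ht.le (by positivity),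
      show α + γ - 1 = α - 1 + γ by ring, Complex.cpow_add _ _ ht_ne, tricomiIntegrand]
    push_cast
    ring
  have h_subst := integral_comp_mul_left_Ioi
    (fun v : ℝ => (v : ℂ) ^ (α - 1) * ((t + v : ℝ) : ℂ) ^ γ * Complex.exp (-v)) 0 ht
  rw [setIntegral_congr_fun measurableSet_Ioi h_scale, integral_const_mul, mul_zero,
    Complex.real_smul, Complex.ofReal_inv, eq_inv_mul_iff_mul_eq₀ ht_ne] at h_subst
  rw [← h_subst, tricomiIntegral, ← mul_assoc, mul_comm (t : ℂ), ← cpow_add_one ht_ne,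
    sub_add_cancel]

theorem tendsto_cpow_mul_tricomiIntegral_nhdsGT_zero {α γ : ℂ} (hγ : γ.re ≤ 0)
    (hαγ : 0 < (α + γ).re) :
    Tendsto (fun t : ℝ => (t : ℂ) ^ (α + γ) * tricomiIntegral α γ t) (𝓝[>] 0)
      (𝓝 (Complex.Gamma (α + γ))) := by
  have h_lim : Tendsto (fun t : ℝ => ∫ v in Ioi (0 : ℝ),
      (v : ℂ) ^ (α - 1) * ((t + v : ℝ) : ℂ) ^ γ * Complex.exp (-v)) (𝓝[>] 0)
      (𝓝 (∫ v in Ioi (0 : ℝ), (v : ℂ) ^ (α + γ - 1) * Complex.exp (-v))) := by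
    refine tendsto_integral_filter_of_dominated_convergence
      (fun v => ‖(v : ℂ) ^ (α + γ - 1) * Complex.exp (-v)‖)
      (Eventually.of_forall fun t => (by fun_prop : Measurable _).aestronglyMeasurable) ?_
      (by simpa using (integrableOn_cpow_mul_exp_neg hαγ one_pos).norm) ?_
    · filter_upwards [self_mem_nhdsWithin] with t ht
      filter_upwards [ae_restrict_mem measurableSet_Ioi] with v hv
      have ht_pos : 0 < t := ht
      have hv_pos : 0 < v := hv
      simp only [norm_mul, Complex.norm_cpow_eq_rpow_re_of_pos hv_pos,
        Complex.norm_cpow_eq_rpow_re_of_pos (add_pos ht_pos hv_pos)]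
      gcongr
      rw [show (α + γ - 1).re = (α - 1).re + γ.re by simp; ring, Real.rpow_add hv_pos]
      gcongr ?_ * ?_
      exact Real.rpow_le_rpow_of_nonpos hv_pos (by linarith) hγ
    · filter_upwards [ae_restrict_mem measurableSet_Ioi] with v hv
      have hv_ne : (v : ℂ) ≠ 0 := mod_cast (ne_of_gt hv)
      have h_cont : ContinuousAt (fun t : ℝ =>
          (v : ℂ) ^ (α - 1) * ((t + v : ℝ) : ℂ) ^ γ * Complex.exp (-v)) 0 :=
        (continuousAt_const.mul (ContinuousAt.cpow (by fun_prop) continuousAt_const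
          (Or.inl (by simpa using hv)))).mul continuousAt_const
      have h_zero := h_cont.tendsto
      rw [show α + γ - 1 = α - 1 + γ by ring, Complex.cpow_add _ _ hv_ne]
      simp only [zero_add] at h_zero
      exact h_zero.mono_left nhdsWithin_le_nhds
  rw [← integral_cpow_mul_exp_neg_one hαγ]
  refine h_lim.congr' ?_
  filter_upwards [self_mem_nhdsWithin] with t ht
  exact (cpow_mul_tricomiIntegral ht α γ).symm

theorem integral_cpow_mul_exp_neg_mul_tricomiIntegral {α γ s : ℂ} (hα : 0 < α.re) (hs : 0 < s.re)
    (hs_gt : 0 < (s - α - γ).re) :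
    ∫ t in Ioi (0 : ℝ), (t : ℂ) ^ (s - 1) * Complex.exp (-t) * tricomiIntegral α γ t =
      Complex.Gamma s * (Complex.Gamma α * Complex.Gamma (s - α - γ) / Complex.Gamma (s - γ)) := by
  have h_kernel : ∀ u ∈ Ioi (0 : ℝ), (u : ℂ) ^ (α - 1) * (1 + u : ℂ) ^ γ * (1 + u : ℂ) ^ (-s) =
      (u : ℂ) ^ (α - 1) * (1 + u : ℂ) ^ (-(α + (s - α - γ))) := by
    intro u hu
    rw [mul_assoc, ← Complex.cpow_add _ _ (one_add_ofReal_ne_zero hu)]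
    ring_nf
  have h_int := (integrableOn_cpow_mul_one_add_cpow hα hs_gt).congr_fun
    (fun u hu => (h_kernel u hu).symm) measurableSet_Ioi
  unfold tricomiIntegral tricomiIntegrand
  rw [integral_cpow_mul_exp_neg_mul_laplace (by fun_prop) hs h_int,
    setIntegral_congr_fun measurableSet_Ioi h_kernel, integral_cpow_mul_one_add_cpow hα hs_gt,
    show α + (s - α - γ) = s - γ by ring]

/-! ### The connection formula -/

/-- `y` solves Kummer's equation `t y'' + (β - t) y' = α y` on the positive half-line and `y'` is
its derivative there. -/
structure IsKummerSolution (α β : ℂ) (y y' : ℝ → ℂ) : Prop where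
  hasDerivAt {t : ℝ} (ht : 0 < t) : HasDerivAt y (y' t) t
  hasDerivAt_deriv {t : ℝ} (ht : 0 < t) : HasDerivAt y' ((α * y t - (β - t) * y' t) / t) t

/-- The Wronskian `y z' - y' z` of two solutions of Kummer's equation with second parameter `β`,
multiplied by the factor `t ^ β e^{-t}` that makes it constant. -/
noncomputable def kummerWronskian (β : ℂ) (y y' z z' : ℝ → ℂ) (t : ℝ) : ℂ :=
  (t : ℂ) ^ β * Complex.exp (-t) * (y t * z' t - y' t * z t)

theorem hasDerivAt_kummerWronskian {α β : ℂ} {y y' z z' : ℝ → ℂ}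
    (hy : IsKummerSolution α β y y') (hz : IsKummerSolution α β z z') {t : ℝ} (ht : 0 < t) :
    HasDerivAt (kummerWronskian β y y' z z') 0 t := by
  have ht_ne : (t : ℂ) ≠ 0 := mod_cast ht.ne'
  have h_exp : HasDerivAt (fun u : ℝ => Complex.exp (-u)) (Complex.exp (-t) * -1) t :=
    (hasDerivAt_id (t : ℂ)).neg.cexp.comp_ofReal
  refine (((hasDerivAt_ofReal_cpow β ht).mul h_exp).mul
    (((hy.hasDerivAt ht).mul (hz.hasDerivAt_deriv ht)).sub
      ((hy.hasDerivAt_deriv ht).mul (hz.hasDerivAt ht)))).congr_deriv ?_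
  have h_pow : (t : ℂ) ^ β = (t : ℂ) ^ (β - 1) * t := by rw [← cpow_add_one ht_ne, sub_add_cancel]
  simp only [Pi.mul_apply, Pi.sub_apply, h_pow]
  field

theorem kummerWronskian_eq_of_tendsto {α β L : ℂ} {y y' z z' : ℝ → ℂ}
    (hy : IsKummerSolution α β y y') (hz : IsKummerSolution α β z z')
    (hL : Tendsto (kummerWronskian β y y' z z') (𝓝[>] 0) (𝓝 L)) {t : ℝ} (ht : 0 < t) :
    kummerWronskian β y y' z z' t = L := by
  have h_const : ∀ s ∈ Ioi (0 : ℝ), kummerWronskian β y y' z z' s =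
      kummerWronskian β y y' z z' t := fun s hs =>
    isOpen_Ioi.is_const_of_deriv_eq_zero isPreconnected_Ioi
      (fun u hu => (hasDerivAt_kummerWronskian hy hz hu).differentiableAt.differentiableWithinAt)
      (fun u hu => (hasDerivAt_kummerWronskian hy hz hu).deriv) hs ht
  exact tendsto_nhds_unique
    (tendsto_const_nhds.congr' (eventually_mem_of_tendsto_nhdsWithin tendsto_id |>.mono
      fun s hs => (h_const s hs).symm)) hL

theorem isKummerSolution_kummerReg (α β : ℂ) :
    IsKummerSolution α β (fun t => kummerReg α β t)
      (fun t => α * kummerReg (α + 1) (β + 1) t) where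
  hasDerivAt {t} _ := (hasDerivAt_kummerReg α β t).comp_ofReal
  hasDerivAt_deriv {t} ht := by
    have ht_ne : (t : ℂ) ≠ 0 := mod_cast ht.ne'
    refine ((hasDerivAt_kummerReg (α + 1) (β + 1) t).comp_ofReal.const_mul α).congr_deriv ?_
    rw [show α + 1 + 1 = α + 2 by ring, show β + 1 + 1 = β + 2 by ring, eq_div_iff ht_ne]
    linear_combination α * kummerReg_ode α β t

theorem hasDerivAt_cpow_mul_kummerReg (a c : ℂ) {t : ℝ} (ht : 0 < t) :
    HasDerivAt (fun t : ℝ => (t : ℂ) ^ (c - 1) * kummerReg a c t)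
      ((t : ℂ) ^ (c - 2) * kummerReg a (c - 1) t) t := by
  have ht_ne : (t : ℂ) ≠ 0 := mod_cast ht.ne'
  refine ((hasDerivAt_ofReal_cpow (c - 1) ht).mul
    (hasDerivAt_kummerReg a c t).comp_ofReal).congr_deriv ?_
  have h_pow : (t : ℂ) ^ (c - 1) = (t : ℂ) ^ (c - 2) * t := by
    rw [← cpow_add_one ht_ne]
    ring_nf
  rw [show c - 1 - 1 = c - 2 by ring, h_pow, kummerReg_sub_one_right]
  ring

theorem isKummerSolution_cpow_mul_kummerReg (α β : ℂ) :
    IsKummerSolution α β (fun t => (t : ℂ) ^ (1 - β) * kummerReg (α - β + 1) (2 - β) t)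
      (fun t => (t : ℂ) ^ (-β) * kummerReg (α - β + 1) (1 - β) t) where
  hasDerivAt ht := by
    have h_deriv := hasDerivAt_cpow_mul_kummerReg (α - β + 1) (2 - β) ht
    rwa [show 2 - β - 1 = 1 - β by ring, show 2 - β - 2 = -β by ring] at h_deriv
  hasDerivAt_deriv {t} ht := by
    have ht_ne : (t : ℂ) ≠ 0 := mod_cast ht.ne'
    have h_deriv := hasDerivAt_cpow_mul_kummerReg (α - β + 1) (1 - β) ht
    rw [show 1 - β - 1 = -β by ring, show 1 - β - 2 = -β - 1 by ring] at h_deriv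
    refine h_deriv.congr_deriv ?_
    have h_pow : (t : ℂ) ^ (1 - β) = (t : ℂ) ^ (-β - 1) * t * t := by
      rw [← cpow_add_one ht_ne, ← cpow_add_one ht_ne]
      ring_nf
    have h_pow' : (t : ℂ) ^ (-β) = (t : ℂ) ^ (-β - 1) * t := by
      rw [← cpow_add_one ht_ne, sub_add_cancel]
    have h_rec := kummerReg_three_term_right (α - β + 1) (2 - β) t
    rw [show 2 - β - 2 = -β by ring, show 2 - β - 1 = 1 - β by ring] at h_rec
    rw [h_rec, h_pow, h_pow', eq_div_iff ht_ne]
    ring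

theorem isKummerSolution_tricomiIntegral {α : ℂ} (hα : 0 < α.re) (β : ℂ) :
    IsKummerSolution α β (tricomiIntegral α (β - α - 1))
      (fun t => -tricomiIntegral (α + 1) (β - α - 1) t) where
  hasDerivAt ht := hasDerivAt_tricomiIntegral hα _ ht
  hasDerivAt_deriv {t} ht := by
    have ht_ne : (t : ℂ) ≠ 0 := mod_cast ht.ne'
    have hα_one : 0 < (α + 1).re := by
      rw [Complex.add_re, Complex.one_re]
      positivity
    refine (hasDerivAt_tricomiIntegral hα_one (β - α - 1) ht).neg.congr_deriv ?_
    rw [eq_div_iff ht_ne, show α + 1 + 1 = α + 2 by ring]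
    linear_combination tricomiIntegral_ode hα (β - α - 1) ht

theorem tendsto_ofReal_nhdsGT_zero : Tendsto (fun t : ℝ => (t : ℂ)) (𝓝[>] 0) (𝓝 0) :=
  (Complex.continuous_ofReal.tendsto' 0 0 Complex.ofReal_zero).mono_left nhdsWithin_le_nhds

theorem tendsto_exp_neg_ofReal_nhdsGT_zero :
    Tendsto (fun t : ℝ => Complex.exp (-t)) (𝓝[>] 0) (𝓝 1) :=
  (Continuous.tendsto' (by fun_prop) 0 1 (by simp)).mono_left nhdsWithin_le_nhds

theorem tendsto_kummerReg_nhdsGT_zero (a c : ℂ) :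
    Tendsto (fun t : ℝ => kummerReg a c t) (𝓝[>] 0) (𝓝 (Complex.Gamma c)⁻¹) := by
  have h_cont : Continuous (kummerReg a c) :=
    continuous_iff_continuousAt.2 fun z => (hasDerivAt_kummerReg a c z).continuousAt
  exact ((h_cont.tendsto' 0 _ (kummerReg_zero a c)).comp tendsto_ofReal_nhdsGT_zero)

theorem kummerWronskian_cpow_mul_kummerReg (α β : ℂ) (y y' : ℝ → ℂ) {t : ℝ} (ht : 0 < t) :
    kummerWronskian β y y' (fun t => (t : ℂ) ^ (1 - β) * kummerReg (α - β + 1) (2 - β) t)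
      (fun t => (t : ℂ) ^ (-β) * kummerReg (α - β + 1) (1 - β) t) t =
    Complex.exp (-t) * (y t * kummerReg (α - β + 1) (1 - β) t -
      t * y' t * kummerReg (α - β + 1) (2 - β) t) := by
  have ht_ne : (t : ℂ) ≠ 0 := mod_cast ht.ne'
  have h_pow : (t : ℂ) ^ (1 - β) = (t : ℂ) ^ (-β) * t := by
    rw [← cpow_add_one ht_ne, neg_add_eq_sub]
  have h_inv : (t : ℂ) ^ β * (t : ℂ) ^ (-β) = 1 := by
    rw [← Complex.cpow_add _ _ ht_ne, add_neg_cancel, Complex.cpow_zero]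
  rw [kummerWronskian, h_pow]
  linear_combination Complex.exp (-t) * (y t * kummerReg (α - β + 1) (1 - β) t -
    t * y' t * kummerReg (α - β + 1) (2 - β) t) * h_inv

theorem kummerWronskian_kummerReg_cpow_mul_kummerReg (α β : ℂ) {t : ℝ} (ht : 0 < t) :
    kummerWronskian β (fun t => kummerReg α β t) (fun t => α * kummerReg (α + 1) (β + 1) t)
      (fun t => (t : ℂ) ^ (1 - β) * kummerReg (α - β + 1) (2 - β) t)
      (fun t => (t : ℂ) ^ (-β) * kummerReg (α - β + 1) (1 - β) t) t =
    (Complex.Gamma β)⁻¹ * (Complex.Gamma (1 - β))⁻¹ := by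
  refine kummerWronskian_eq_of_tendsto (isKummerSolution_kummerReg α β)
    (isKummerSolution_cpow_mul_kummerReg α β) ?_ ht
  have h_lim := tendsto_exp_neg_ofReal_nhdsGT_zero.mul
    (((tendsto_kummerReg_nhdsGT_zero α β).mul
      (tendsto_kummerReg_nhdsGT_zero (α - β + 1) (1 - β))).sub
    ((tendsto_ofReal_nhdsGT_zero.mul
      ((tendsto_kummerReg_nhdsGT_zero (α + 1) (β + 1)).const_mul α)).mul
      (tendsto_kummerReg_nhdsGT_zero (α - β + 1) (2 - β))))
  rw [zero_mul, zero_mul, sub_zero, one_mul] at h_lim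
  refine h_lim.congr' ?_
  filter_upwards [self_mem_nhdsWithin] with s hs
  rw [kummerWronskian_cpow_mul_kummerReg α β _ _ hs]

theorem tendsto_cpow_mul_tricomiIntegral_add_one {α β : ℂ} (hα : 0 < α.re) (hβ : 0 < β.re)
    (hβ_lt : β.re < 1) :
    Tendsto (fun t : ℝ => (t : ℂ) ^ β * tricomiIntegral (α + 1) (β - α - 1) t) (𝓝[>] 0)
      (𝓝 (Complex.Gamma β)) := by
  have h_sum : α + 1 + (β - α - 1) = β := by ring
  have h_lim := tendsto_cpow_mul_tricomiIntegral_nhdsGT_zero (α := α + 1) (γ := β - α - 1)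
    (by simp only [Complex.sub_re, Complex.one_re]; linarith) (by rwa [h_sum])
  rwa [h_sum] at h_lim

theorem tendsto_mul_tricomiIntegral_add_one {α β : ℂ} (hα : 0 < α.re) (hβ : 0 < β.re)
    (hβ_lt : β.re < 1) :
    Tendsto (fun t : ℝ => t * tricomiIntegral (α + 1) (β - α - 1) t) (𝓝[>] 0) (𝓝 0) := by
  have h_lim := (tendsto_ofReal_cpow_nhdsGT_zero (s := 1 - β)
    (by rw [Complex.sub_re, Complex.one_re]; linarith)).mul
      (tendsto_cpow_mul_tricomiIntegral_add_one hα hβ hβ_lt)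
  rw [zero_mul] at h_lim
  refine h_lim.congr' ?_
  filter_upwards [self_mem_nhdsWithin] with t ht
  have ht_ne : (t : ℂ) ≠ 0 := mod_cast (mem_Ioi.1 ht).ne'
  rw [← mul_assoc, ← Complex.cpow_add _ _ ht_ne, sub_add_cancel, Complex.cpow_one]

theorem tendsto_tricomiIntegral_kummer {α β : ℂ} (hα : 0 < α.re) (hβ : β.re < 1) :
    Tendsto (tricomiIntegral α (β - α - 1)) (𝓝[>] 0)
      (𝓝 (Complex.Gamma α * Complex.Gamma (1 - β) / Complex.Gamma (α - β + 1))) := by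
  have h_lim := tendsto_tricomiIntegral_nhdsGT_zero (γ := β - α - 1) hα
    (by simp only [Complex.add_re, Complex.sub_re, Complex.one_re]; linarith)
  rwa [show -(α + (β - α - 1)) = 1 - β by ring, show -(β - α - 1) = α - β + 1 by ring] at h_lim

theorem kummerWronskian_tricomiIntegral_cpow_mul_kummerReg {α β : ℂ} (hα : 0 < α.re)
    (hβ : 0 < β.re) (hβ_lt : β.re < 1) {t : ℝ} (ht : 0 < t) :
    kummerWronskian β (tricomiIntegral α (β - α - 1))
      (fun t => -tricomiIntegral (α + 1) (β - α - 1) t)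
      (fun t => (t : ℂ) ^ (1 - β) * kummerReg (α - β + 1) (2 - β) t)
      (fun t => (t : ℂ) ^ (-β) * kummerReg (α - β + 1) (1 - β) t) t =
    Complex.Gamma α * (Complex.Gamma (α - β + 1))⁻¹ := by
  refine kummerWronskian_eq_of_tendsto (isKummerSolution_tricomiIntegral hα β)
    (isKummerSolution_cpow_mul_kummerReg α β) ?_ ht
  have h_lim := tendsto_exp_neg_ofReal_nhdsGT_zero.mul
    (((tendsto_tricomiIntegral_kummer hα hβ_lt).mul
      (tendsto_kummerReg_nhdsGT_zero (α - β + 1) (1 - β))).add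
    ((tendsto_mul_tricomiIntegral_add_one hα hβ hβ_lt).mul
      (tendsto_kummerReg_nhdsGT_zero (α - β + 1) (2 - β))))
  have hΓ : Complex.Gamma (1 - β) ≠ 0 := Complex.Gamma_ne_zero_of_re_pos (by
    rw [Complex.sub_re, Complex.one_re]
    linarith)
  rw [zero_mul, add_zero, one_mul, div_mul_eq_mul_div, mul_inv_cancel_right₀ hΓ,
    div_eq_mul_inv] at h_lim
  refine h_lim.congr' ?_
  filter_upwards [self_mem_nhdsWithin] with s hs
  rw [kummerWronskian_cpow_mul_kummerReg α β _ _ hs]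
  ring

theorem kummerWronskian_tricomiIntegral_kummerReg {α β : ℂ} (hα : 0 < α.re) (hβ : 0 < β.re)
    (hβ_lt : β.re < 1) {t : ℝ} (ht : 0 < t) :
    kummerWronskian β (tricomiIntegral α (β - α - 1))
      (fun t => -tricomiIntegral (α + 1) (β - α - 1) t) (fun t => kummerReg α β t)
      (fun t => α * kummerReg (α + 1) (β + 1) t) t = 1 := by
  refine kummerWronskian_eq_of_tendsto (isKummerSolution_tricomiIntegral hα β)
    (isKummerSolution_kummerReg α β) ?_ ht
  have h_lim := tendsto_exp_neg_ofReal_nhdsGT_zero.mul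
    ((((tendsto_ofReal_cpow_nhdsGT_zero hβ).mul (tendsto_tricomiIntegral_kummer hα hβ_lt)).mul
      ((tendsto_kummerReg_nhdsGT_zero (α + 1) (β + 1)).const_mul α)).add
    ((tendsto_cpow_mul_tricomiIntegral_add_one hα hβ hβ_lt).mul
      (tendsto_kummerReg_nhdsGT_zero α β)))
  rw [zero_mul, zero_mul, zero_add, one_mul,
    mul_inv_cancel₀ (Complex.Gamma_ne_zero_of_re_pos hβ)] at h_lim
  refine h_lim.congr fun s => ?_
  rw [kummerWronskian]
  ring

theorem tricomiIntegral_connection_of_re_mem {α β : ℂ} (hα : 0 < α.re) (hβ : 0 < β.re)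
    (hβ_lt : β.re < 1) {t : ℝ} (ht : 0 < t) :
    (Complex.Gamma β)⁻¹ * (Complex.Gamma (1 - β))⁻¹ * tricomiIntegral α (β - α - 1) t =
      Complex.Gamma α * (Complex.Gamma (α - β + 1))⁻¹ * kummerReg α β t -
        (t : ℂ) ^ (1 - β) * kummerReg (α - β + 1) (2 - β) t := by
  have h_one := kummerWronskian_tricomiIntegral_kummerReg hα hβ hβ_lt ht
  rw [← kummerWronskian_kummerReg_cpow_mul_kummerReg α β ht,
    ← kummerWronskian_tricomiIntegral_cpow_mul_kummerReg hα hβ hβ_lt ht]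
  unfold kummerWronskian at h_one ⊢
  linear_combination (-(t : ℂ) ^ (1 - β) * kummerReg (α - β + 1) (2 - β) t) * h_one

/-- Multiplying by the reciprocal Gamma factors makes both sides entire in `β`, so that there are
no exceptional parameters. -/
theorem tricomiIntegral_connection {α : ℂ} (hα : 0 < α.re) (β : ℂ) {t : ℝ} (ht : 0 < t) :
    (Complex.Gamma β)⁻¹ * (Complex.Gamma (1 - β))⁻¹ * tricomiIntegral α (β - α - 1) t =
      Complex.Gamma α * (Complex.Gamma (α - β + 1))⁻¹ * kummerReg α β t -
        (t : ℂ) ^ (1 - β) * kummerReg (α - β + 1) (2 - β) t := by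
  have ht_ne : (t : ℂ) ≠ 0 := mod_cast ht.ne'
  have hΓ := Complex.differentiable_one_div_Gamma
  have h_left : Differentiable ℂ fun β : ℂ =>
      (Complex.Gamma β)⁻¹ * (Complex.Gamma (1 - β))⁻¹ * tricomiIntegral α (β - α - 1) t :=
    (hΓ.mul (hΓ.comp (by fun_prop : Differentiable ℂ fun β : ℂ => 1 - β))).mul
      ((differentiable_tricomiIntegral hα ht).comp
        (by fun_prop : Differentiable ℂ fun β : ℂ => β - α - 1))
  have h_right : Differentiable ℂ fun β : ℂ =>
      Complex.Gamma α * (Complex.Gamma (α - β + 1))⁻¹ * kummerReg α β t -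
        (t : ℂ) ^ (1 - β) * kummerReg (α - β + 1) (2 - β) t :=
    (((hΓ.comp (by fun_prop : Differentiable ℂ fun β : ℂ => α - β + 1)).const_mul _).mul
      (differentiable_kummerReg_comp (by fun_prop) (by fun_prop) (by fun_prop))).sub
      (((by fun_prop : Differentiable ℂ fun β : ℂ => 1 - β).const_cpow (Or.inl ht_ne)).mul
        (differentiable_kummerReg_comp (by fun_prop) (by fun_prop) (by fun_prop)))
  refine congrFun (AnalyticOnNhd.eq_of_eventuallyEq (z₀ := (1 / 2 : ℂ))
    (fun z _ => h_left.analyticAt z) (fun z _ => h_right.analyticAt z) ?_) β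
  have h_re : ContinuousAt Complex.re (1 / 2 : ℂ) := Complex.continuous_re.continuousAt
  filter_upwards [h_re.eventually_const_lt (by norm_num : (0 : ℝ) < (1 / 2 : ℂ).re),
    h_re.eventually_lt_const (by norm_num : (1 / 2 : ℂ).re < 1)] with β hβ hβ_lt
  exact tricomiIntegral_connection_of_re_mem hα hβ hβ_lt ht

/-! ### The Whittaker function -/

theorem whittakerConnection_eq_kummerReg (τ : ℂ) {s : ℂ} (hs : ∀ n : ℤ, 2 * s ≠ n) (z : ℂ) :
    whittakerConnection τ s z = Complex.Gamma (-2 * s) * Complex.Gamma (2 * s + 1) *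
      Complex.exp (-z / 2) *
      (z ^ (1 / 2 + s) *
          ((Complex.Gamma (1 / 2 - τ - s))⁻¹ * kummerReg (1 / 2 + s - τ) (2 * s + 1) z) -
        z ^ (1 / 2 - s) *
          ((Complex.Gamma (1 / 2 - τ + s))⁻¹ * kummerReg (1 / 2 - s - τ) (1 - 2 * s) z)) := by
  have hs_ne : 2 * s ≠ 0 := by simpa using hs 0
  have h_plus : ∀ k : ℕ, 2 * s + 1 ≠ -k := fun k h =>
    hs (-k - 1) (by push_cast; linear_combination h)
  have h_minus : ∀ k : ℕ, 2 * -s + 1 ≠ -k := fun k h =>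
    hs (k + 1) (by push_cast; linear_combination -h)
  have hΓ_plus := Complex.Gamma_add_one (2 * s) hs_ne
  have hΓ_minus := Complex.Gamma_add_one (-2 * s) (by simpa using hs_ne)
  rw [whittakerConnection, whittakerM, whittakerM, kummerF_eq_Gamma_mul_kummerReg _ h_plus,
    kummerF_eq_Gamma_mul_kummerReg _ h_minus, show 2 * -s + 1 = -2 * s + 1 by ring, hΓ_plus,
    hΓ_minus, show 1 / 2 + -s = 1 / 2 - s by ring, show -2 * s + 1 = 1 - 2 * s by ring]
  ring

theorem inv_Gamma_mul_kummerReg_recurrence (τ s z : ℂ) :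
    (Complex.Gamma (1 / 2 - (τ + 1) - s))⁻¹ * kummerReg (1 / 2 + s - (τ + 1)) (2 * s + 1) z =
      (z - 2 * τ) * ((Complex.Gamma (1 / 2 - τ - s))⁻¹ * kummerReg (1 / 2 + s - τ) (2 * s + 1) z) -
      ((τ - 1 / 2) ^ 2 - s ^ 2) * ((Complex.Gamma (1 / 2 - (τ - 1) - s))⁻¹ *
        kummerReg (1 / 2 + s - (τ - 1)) (2 * s + 1) z) := by
  have h_contiguous := kummerReg_contiguous (1 / 2 + s - τ) (2 * s + 1) z
  have hΓ := Complex.one_div_Gamma_eq_self_mul_one_div_Gamma_add_one (1 / 2 - τ - s)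
  have hΓ_pred := Complex.one_div_Gamma_eq_self_mul_one_div_Gamma_add_one (1 / 2 - (τ + 1) - s)
  rw [show 1 / 2 - (τ + 1) - s + 1 = 1 / 2 - τ - s by ring] at hΓ_pred
  rw [hΓ_pred, hΓ, show 1 / 2 - (τ - 1) - s = 1 / 2 - τ - s + 1 by ring,
    show 1 / 2 + s - (τ + 1) = 1 / 2 + s - τ - 1 by ring,
    show 1 / 2 + s - (τ - 1) = 1 / 2 + s - τ + 1 by ring]
  linear_combination (1 / 2 - τ - s) * (Complex.Gamma (1 / 2 - τ - s + 1))⁻¹ * h_contiguous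

theorem whittakerConnection_recurrence (τ : ℂ) {s : ℂ} (hs : ∀ n : ℤ, 2 * s ≠ n) (z : ℂ) :
    whittakerConnection (τ + 1) s z = (z - 2 * τ) * whittakerConnection τ s z -
      ((τ - 1 / 2) ^ 2 - s ^ 2) * whittakerConnection (τ - 1) s z := by
  have h_plus := inv_Gamma_mul_kummerReg_recurrence τ s z
  have h_minus := inv_Gamma_mul_kummerReg_recurrence τ (-s) z
  simp only [sub_neg_eq_add, ← sub_eq_add_neg, show 2 * -s + 1 = 1 - 2 * s by ring,
    neg_sq] at h_minus
  simp only [whittakerConnection_eq_kummerReg _ hs, h_plus, h_minus]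
  ring

theorem whittakerConnection_eq_tricomiIntegral {τ s : ℂ} (hs : ∀ n : ℤ, 2 * s ≠ n)
    (hα : 0 < (1 / 2 + s - τ).re) {t : ℝ} (ht : 0 < t) :
    whittakerConnection τ s t = Complex.exp (-t / 2) * (t : ℂ) ^ (1 / 2 + s) *
      ((Complex.Gamma (1 / 2 + s - τ))⁻¹ *
        tricomiIntegral (1 / 2 + s - τ) (s + τ - 1 / 2) t) := by
  have ht_ne : (t : ℂ) ≠ 0 := mod_cast ht.ne'
  have hΓα : Complex.Gamma (1 / 2 + s - τ) ≠ 0 := Complex.Gamma_ne_zero_of_re_pos hα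
  have hΓβ : Complex.Gamma (2 * s + 1) ≠ 0 := Complex.Gamma_ne_zero fun k h =>
    hs (-k - 1) (by push_cast; linear_combination h)
  have hΓβ' : Complex.Gamma (-2 * s) ≠ 0 := Complex.Gamma_ne_zero fun k h =>
    hs k (by push_cast; linear_combination -h)
  have h_conn := tricomiIntegral_connection hα (2 * s + 1) ht
  rw [show 2 * s + 1 - (1 / 2 + s - τ) - 1 = s + τ - 1 / 2 by ring,
    show 1 / 2 + s - τ - (2 * s + 1) + 1 = 1 / 2 - τ - s by ring,
    show 1 - (2 * s + 1) = -2 * s by ring, show 2 - (2 * s + 1) = 1 - 2 * s by ring, mul_assoc,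
    inv_mul_eq_iff_eq_mul₀ hΓβ, inv_mul_eq_iff_eq_mul₀ hΓβ'] at h_conn
  have h_pow : (t : ℂ) ^ (1 / 2 - s) = (t : ℂ) ^ (1 / 2 + s) * (t : ℂ) ^ (-2 * s) := by
    rw [← Complex.cpow_add _ _ ht_ne]
    ring_nf
  rw [whittakerConnection_eq_kummerReg _ hs, h_conn, h_pow,
    show 1 / 2 - s - τ = 1 / 2 - τ - s by ring, show 1 / 2 - τ + s = 1 / 2 + s - τ by ring]
  linear_combination -Complex.Gamma (-2 * s) * Complex.Gamma (2 * s + 1) *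
    Complex.exp (-t / 2) * (t : ℂ) ^ (1 / 2 + s) * ((Complex.Gamma (1 / 2 - τ - s))⁻¹ *
    kummerReg (1 / 2 + s - τ) (2 * s + 1) t) * mul_inv_cancel₀ hΓα

theorem eventually_two_mul_ne_intCast (ω : ℂ) :
    ∀ᶠ s : ℂ in 𝓝[≠] ω, ∀ n : ℤ, 2 * s ≠ n := by
  have h_closed : IsClosed (((↑) : ℤ → ℂ) '' {n | (n : ℂ) ≠ 2 * ω}) :=
    Complex.isClosedEmbedding_intCast.isClosedMap _ (isClosed_discrete _)
  have h_far : ∀ᶠ z : ℂ in 𝓝[≠] (2 * ω), z ∉ ((↑) : ℤ → ℂ) '' {n | (n : ℂ) ≠ 2 * ω} :=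
    nhdsWithin_le_nhds (h_closed.isOpen_compl.mem_nhds fun ⟨_, hn, h⟩ => hn h)
  have h_two : Tendsto (fun s : ℂ => 2 * s) (𝓝[≠] ω) (𝓝[≠] (2 * ω)) :=
    (ContinuousAt.tendsto (by fun_prop)).inf
      (tendsto_principal_principal.2 fun s hs h => hs (mul_left_cancel₀ two_ne_zero h))
  filter_upwards [h_two.eventually h_far, h_two.eventually self_mem_nhdsWithin] with s hs hs_ne n hn
  exact hs ⟨n, fun h => hs_ne (hn.trans h), hn.symm⟩

theorem tendsto_whittakerConnection_of_ne_intCast (τ : ℂ) {ω z : ℂ} (hω : ∀ n : ℤ, 2 * ω ≠ n)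
    (hz : z ≠ 0) :
    Tendsto (fun s => whittakerConnection τ s z) (𝓝[≠] ω) (𝓝 (whittakerConnection τ ω z)) := by
  have hΓ_left : ContinuousAt (fun s : ℂ => Complex.Gamma (-2 * s)) ω :=
    (Complex.differentiableAt_Gamma _ fun k h =>
      hω k (by push_cast; linear_combination -h)).continuousAt.comp
        (f := fun s : ℂ => -2 * s) (by fun_prop)
  have hΓ_right : ContinuousAt (fun s : ℂ => Complex.Gamma (2 * s + 1)) ω :=
    (Complex.differentiableAt_Gamma _ fun k h =>
      hω (-k - 1) (by push_cast; linear_combination h)).continuousAt.comp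
        (f := fun s : ℂ => 2 * s + 1) (by fun_prop)
  have h_half : ∀ ε : ℂ, ContinuousAt (fun s : ℂ => z ^ (1 / 2 + ε * s) *
      ((Complex.Gamma (1 / 2 - τ - ε * s))⁻¹ *
        kummerReg (1 / 2 + ε * s - τ) (2 * (ε * s) + 1) z)) ω := fun ε =>
    ((ContinuousAt.const_cpow (by fun_prop) (Or.inl hz)).mul
      ((Complex.differentiable_one_div_Gamma.continuous.comp
        (by fun_prop : Continuous fun s : ℂ => 1 / 2 - τ - ε * s)).mul
      (differentiable_kummerReg_comp (by fun_prop) (by fun_prop)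
        (differentiable_const z)).continuous).continuousAt)
  have h_cont : ContinuousAt (fun s => Complex.Gamma (-2 * s) * Complex.Gamma (2 * s + 1) *
      Complex.exp (-z / 2) *
      (z ^ (1 / 2 + s) *
          ((Complex.Gamma (1 / 2 - τ - s))⁻¹ * kummerReg (1 / 2 + s - τ) (2 * s + 1) z) -
        z ^ (1 / 2 - s) *
          ((Complex.Gamma (1 / 2 - τ + s))⁻¹ * kummerReg (1 / 2 - s - τ) (1 - 2 * s) z))) ω := by
    refine ((hΓ_left.mul hΓ_right).mul_const _).mul (ContinuousAt.sub ?_ ?_)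
    · simpa only [one_mul] using h_half 1
    · convert h_half (-1) using 7 <;> ring
  rw [whittakerConnection_eq_kummerReg τ hω]
  refine (h_cont.tendsto.mono_left nhdsWithin_le_nhds).congr' ?_
  filter_upwards [eventually_two_mul_ne_intCast ω] with s hs
  exact (whittakerConnection_eq_kummerReg τ hs z).symm

theorem whittakerW_eq_of_tendsto {τ ω z L : ℂ} (hz : z ≠ 0)
    (hL : Tendsto (fun s => whittakerConnection τ s z) (𝓝[≠] ω) (𝓝 L)) :
    whittakerW τ ω z = L := by
  unfold whittakerW
  split_ifs with hω
  · exact hL.limUnder_eq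
  · push Not at hω
    exact tendsto_nhds_unique (tendsto_whittakerConnection_of_ne_intCast τ hω hz) hL

theorem tendsto_whittakerConnection_tricomiIntegral {τ ω : ℂ} (hα : 0 < (1 / 2 + ω - τ).re)
    {t : ℝ} (ht : 0 < t) :
    Tendsto (fun s => whittakerConnection τ s t) (𝓝[≠] ω)
      (𝓝 (Complex.exp (-t / 2) * (t : ℂ) ^ (1 / 2 + ω) * ((Complex.Gamma (1 / 2 + ω - τ))⁻¹ *
        tricomiIntegral (1 / 2 + ω - τ) (ω + τ - 1 / 2) t))) := by
  have ht_ne : (t : ℂ) ≠ 0 := mod_cast ht.ne'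
  have h_pow : ContinuousAt (fun s : ℂ => (t : ℂ) ^ (1 / 2 + s)) ω :=
    ContinuousAt.const_cpow (by fun_prop) (Or.inl ht_ne)
  have h_inv_Gamma : Continuous fun s : ℂ => (Complex.Gamma (1 / 2 + s - τ))⁻¹ :=
    Complex.differentiable_one_div_Gamma.continuous.comp
      (by fun_prop : Continuous fun s : ℂ => 1 / 2 + s - τ)
  have h_integral :
      ContinuousAt (fun s : ℂ => tricomiIntegral (1 / 2 + s - τ) (s + τ - 1 / 2) t) ω :=
    continuousAt_tricomiIntegral (f := fun s => 1 / 2 + s - τ) (g := fun s => s + τ - 1 / 2)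
      (by fun_prop) (by fun_prop) hα ht
  have h_re : ContinuousAt (fun s : ℂ => (1 / 2 + s - τ).re) ω := by fun_prop
  refine (((h_pow.const_mul _).mul (h_inv_Gamma.continuousAt.mul h_integral)).tendsto.mono_left
    nhdsWithin_le_nhds).congr' ?_
  filter_upwards [eventually_two_mul_ne_intCast ω,
    nhdsWithin_le_nhds (h_re.eventually_const_lt hα)] with s hs hs_re
  exact (whittakerConnection_eq_tricomiIntegral hs hs_re ht).symm

theorem tendsto_whittakerConnection_step {τ ω z L L' : ℂ}
    (hL : Tendsto (fun s => whittakerConnection τ s z) (𝓝[≠] ω) (𝓝 L))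
    (hL' : Tendsto (fun s => whittakerConnection (τ - 1) s z) (𝓝[≠] ω) (𝓝 L')) :
    Tendsto (fun s => whittakerConnection (τ + 1) s z) (𝓝[≠] ω)
      (𝓝 ((z - 2 * τ) * L - ((τ - 1 / 2) ^ 2 - ω ^ 2) * L')) := by
  have h_coeff : Tendsto (fun s : ℂ => (τ - 1 / 2) ^ 2 - s ^ 2) (𝓝[≠] ω)
      (𝓝 ((τ - 1 / 2) ^ 2 - ω ^ 2)) :=
    (Continuous.tendsto (by fun_prop) ω).mono_left nhdsWithin_le_nhds
  refine ((hL.const_mul (z - 2 * τ)).sub (h_coeff.mul hL')).congr' ?_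
  filter_upwards [eventually_two_mul_ne_intCast ω] with s hs
  exact (whittakerConnection_recurrence τ hs z).symm

theorem forall_of_re_lt_of_step {P : ℂ → Prop} (B : ℝ) (h_base : ∀ τ : ℂ, τ.re < B → P τ)
    (h_step : ∀ τ, P τ → P (τ - 1) → P (τ + 1)) (τ : ℂ) : P τ := by
  have h_nat : ∀ (n : ℕ) (τ : ℂ), τ.re < B + n → P τ := by
    intro n
    induction n with
    | zero => exact fun τ hτ => h_base τ (by simpa using hτ)
    | succ n ih =>
      intro τ hτ
      push_cast at hτ
      rw [← sub_add_cancel τ 1]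
      refine h_step _ (ih _ ?_) (ih _ ?_) <;>
        simp only [Complex.sub_re, Complex.one_re] <;> linarith
  obtain ⟨n, hn⟩ := exists_nat_gt (τ.re - B)
  exact h_nat n τ (by linarith)

/-- By the three-term recurrence in `τ` it suffices to treat the half-plane in which Tricomi's
integral represents `W_{τ,ω}`. -/
theorem whittaker_induction {P : ℂ → Prop} (ω : ℂ)
    (h_base : ∀ τ : ℂ, 0 < (1 / 2 + ω - τ).re → P τ)
    (h_step : ∀ τ, P τ → P (τ - 1) → P (τ + 1)) (τ : ℂ) : P τ := by
  refine forall_of_re_lt_of_step (1 / 2 + ω.re) (fun τ hτ => h_base τ ?_) h_step τ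
  have h_half : (1 / 2 : ℂ).re = 1 / 2 := by norm_num
  rw [Complex.sub_re, Complex.add_re, h_half]
  linarith

theorem tendsto_whittakerConnection (τ ω : ℂ) {t : ℝ} (ht : 0 < t) :
    Tendsto (fun s => whittakerConnection τ s t) (𝓝[≠] ω) (𝓝 (whittakerW τ ω t)) := by
  have ht_ne : (t : ℂ) ≠ 0 := mod_cast ht.ne'
  suffices ∃ L, Tendsto (fun s => whittakerConnection τ s t) (𝓝[≠] ω) (𝓝 L) by
    obtain ⟨L, hL⟩ := this
    rwa [whittakerW_eq_of_tendsto ht_ne hL]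
  refine whittaker_induction
    (P := fun τ => ∃ L, Tendsto (fun s => whittakerConnection τ s t) (𝓝[≠] ω) (𝓝 L)) ω
    (fun τ hα => ⟨_, tendsto_whittakerConnection_tricomiIntegral hα ht⟩) ?_ τ
  rintro τ ⟨L, hL⟩ ⟨L', hL'⟩
  exact ⟨_, tendsto_whittakerConnection_step hL hL'⟩

theorem whittakerW_eq_tricomiIntegral {τ ω : ℂ} (hα : 0 < (1 / 2 + ω - τ).re) {t : ℝ}
    (ht : 0 < t) :
    whittakerW τ ω t = Complex.exp (-t / 2) * (t : ℂ) ^ (1 / 2 + ω) *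
      ((Complex.Gamma (1 / 2 + ω - τ))⁻¹ *
        tricomiIntegral (1 / 2 + ω - τ) (ω + τ - 1 / 2) t) :=
  whittakerW_eq_of_tendsto (mod_cast ht.ne') (tendsto_whittakerConnection_tricomiIntegral hα ht)

theorem whittakerW_recurrence (τ ω : ℂ) {t : ℝ} (ht : 0 < t) :
    whittakerW (τ + 1) ω t =
      (t - 2 * τ) * whittakerW τ ω t - ((τ - 1 / 2) ^ 2 - ω ^ 2) * whittakerW (τ - 1) ω t :=
  whittakerW_eq_of_tendsto (mod_cast ht.ne') (tendsto_whittakerConnection_step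
    (tendsto_whittakerConnection τ ω ht) (tendsto_whittakerConnection (τ - 1) ω ht))

theorem continuousOn_whittakerW (τ ω : ℂ) :
    ContinuousOn (fun t : ℝ => whittakerW τ ω t) (Ioi 0) := by
  refine whittaker_induction (P := fun τ => ContinuousOn (fun t : ℝ => whittakerW τ ω t) (Ioi 0)) ω
    (fun τ hα => ?_) (fun τ h h' => ?_) τ
  · refine ContinuousOn.congr (fun t ht => ContinuousAt.continuousWithinAt ?_)
      fun t ht => whittakerW_eq_tricomiIntegral hα ht
    exact ((by fun_prop : ContinuousAt (fun t : ℝ => Complex.exp (-t / 2)) t).mul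
      (hasDerivAt_ofReal_cpow _ ht).continuousAt).mul
      (continuousAt_const.mul (hasDerivAt_tricomiIntegral hα _ ht).continuousAt)
  · exact ContinuousOn.congr (((by fun_prop :
      Continuous fun t : ℝ => (t : ℂ) - 2 * τ).continuousOn.mul h).sub (h'.const_mul _))
      fun t ht => whittakerW_recurrence τ ω ht

/-! ### The Mellin transform of the Whittaker function -/

/-- The weight `e^{-t/2} W_{τ,ω}(t)` of the Whittaker transform. -/
noncomputable def whittakerWeight (τ ω : ℂ) (t : ℝ) : ℂ :=
  Complex.exp (-t / 2) * whittakerW τ ω t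

theorem continuousOn_whittakerWeight (τ ω : ℂ) : ContinuousOn (whittakerWeight τ ω) (Ioi 0) :=
  (by fun_prop : Continuous fun t : ℝ => Complex.exp (-t / 2)).continuousOn.mul
    (continuousOn_whittakerW τ ω)

theorem whittakerWeight_recurrence (τ ω : ℂ) {t : ℝ} (ht : 0 < t) :
    whittakerWeight (τ + 1) ω t = (t : ℂ) ^ (1 : ℂ) • whittakerWeight τ ω t -
      (2 * τ) • whittakerWeight τ ω t -
      ((τ - 1 / 2) ^ 2 - ω ^ 2) • whittakerWeight (τ - 1) ω t := by
  simp only [whittakerWeight, whittakerW_recurrence τ ω ht, Complex.cpow_one, smul_eq_mul]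
  ring

theorem whittakerWeight_eq_tricomiIntegral {τ ω : ℂ} (hα : 0 < (1 / 2 + ω - τ).re) {t : ℝ}
    (ht : 0 < t) :
    whittakerWeight τ ω t = (Complex.Gamma (1 / 2 + ω - τ))⁻¹ * ((t : ℂ) ^ (1 / 2 + ω) *
      (Complex.exp (-t) * tricomiIntegral (1 / 2 + ω - τ) (ω + τ - 1 / 2) t)) := by
  rw [whittakerWeight, whittakerW_eq_tricomiIntegral hα ht,
    show Complex.exp (-t) = Complex.exp (-t / 2) * Complex.exp (-t / 2) by
      rw [← Complex.exp_add, add_halves]]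
  ring

theorem exists_norm_whittakerWeight_le_of_re_pos {τ ω : ℂ} {θ : ℝ}
    (hα : 0 < (1 / 2 + ω - τ).re) (hθ : |ω.re| < θ) :
    ∃ C N : ℝ, 0 ≤ C ∧ 1 / 2 - θ ≤ N ∧ ∀ t : ℝ, 0 < t →
      ‖whittakerWeight τ ω t‖ ≤ C * (Real.exp (-t) * (t ^ (1 / 2 - θ) + t ^ N)) := by
  obtain ⟨hω_neg, hω_pos⟩ := abs_lt.1 hθ
  obtain ⟨C, hC, h_bound⟩ := exists_norm_tricomiIntegral_le (γ := ω + τ - 1 / 2)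
    (δ := θ + ω.re) hα (by linarith) (by
      rw [show 1 / 2 + ω - τ + (ω + τ - 1 / 2) = ω + ω by ring, Complex.add_re]
      linarith)
  refine ⟨‖(Complex.Gamma (1 / 2 + ω - τ))⁻¹‖ * C, 1 / 2 + ω.re, by positivity, by linarith,
    fun t ht => ?_⟩
  have h_exp : ‖Complex.exp (-t)‖ = Real.exp (-t) := by simp [Complex.norm_exp]
  have h_pow : ‖(t : ℂ) ^ (1 / 2 + ω)‖ = t ^ (1 / 2 + ω.re) := by
    rw [Complex.norm_cpow_eq_rpow_re_of_pos ht]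
    norm_num
  have h_split : t ^ (1 / 2 - θ) = t ^ (1 / 2 + ω.re) * t ^ (-(θ + ω.re)) := by
    rw [← Real.rpow_add ht]
    ring_nf
  rw [whittakerWeight_eq_tricomiIntegral hα ht, norm_mul, norm_mul, norm_mul, h_exp, h_pow]
  calc _ ≤ ‖(Complex.Gamma (1 / 2 + ω - τ))⁻¹‖ * (t ^ (1 / 2 + ω.re) *
        (Real.exp (-t) * (C * (t ^ (-(θ + ω.re)) + 1)))) := by
        gcongr
        exact h_bound t ht
    _ = _ := by rw [h_split]; ring

theorem exists_norm_whittakerWeight_le (τ : ℂ) {ω : ℂ} {θ : ℝ} (hθ : |ω.re| < θ) :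
    ∃ C N : ℝ, 0 ≤ C ∧ 1 / 2 - θ ≤ N ∧ ∀ t : ℝ, 0 < t →
      ‖whittakerWeight τ ω t‖ ≤ C * (Real.exp (-t) * (t ^ (1 / 2 - θ) + t ^ N)) := by
  refine whittaker_induction (P := fun τ => ∃ C N : ℝ, 0 ≤ C ∧ 1 / 2 - θ ≤ N ∧ ∀ t : ℝ, 0 < t →
      ‖whittakerWeight τ ω t‖ ≤ C * (Real.exp (-t) * (t ^ (1 / 2 - θ) + t ^ N))) ω
    (fun τ hα => exists_norm_whittakerWeight_le_of_re_pos hα hθ) ?_ τ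
  rintro τ ⟨C₁, N₁, hC₁, hN₁, h₁⟩ ⟨C₂, N₂, hC₂, hN₂, h₂⟩
  set A := 1 / 2 - θ
  set N := max N₁ N₂ + 1 with hN
  have hN₁_le : N₁ + 1 ≤ N := by simp [hN]
  have hN₂_le : N₂ + 1 ≤ N := by simp [hN]
  refine ⟨C₁ * (2 + 2 * ‖2 * τ‖) + ‖(τ - 1 / 2) ^ 2 - ω ^ 2‖ * C₂ * 2, N, by positivity,
    by linarith, fun t ht => ?_⟩
  have h_mid : ∀ B, A ≤ B → B ≤ N → t ^ B ≤ t ^ A + t ^ N := fun B hA hB =>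
    rpow_le_rpow_add_rpow ht hA hB
  have h_A := h_mid A le_rfl (by linarith)
  have h_succ : t * (t ^ A + t ^ N₁) ≤ 2 * (t ^ A + t ^ N) := by
    have h_A_succ := h_mid (A + 1) (by linarith) (by linarith)
    have h_N_succ := h_mid (N₁ + 1) (by linarith) hN₁_le
    rw [Real.rpow_add_one ht.ne'] at h_A_succ h_N_succ
    linarith
  have h_N₁ : t ^ A + t ^ N₁ ≤ 2 * (t ^ A + t ^ N) := by
    linarith [h_mid N₁ hN₁ (by linarith)]
  have h_N₂ : t ^ A + t ^ N₂ ≤ 2 * (t ^ A + t ^ N) := by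
    linarith [h_mid N₂ hN₂ (by linarith)]
  have h_norm_t : ‖(t : ℂ) ^ (1 : ℂ)‖ = t := by
    rw [Complex.cpow_one, Complex.norm_real, Real.norm_of_nonneg ht.le]
  rw [whittakerWeight_recurrence τ ω ht]
  refine (norm_sub_le _ _).trans ((add_le_add_left (norm_sub_le _ _) _).trans ?_)
  rw [norm_smul, norm_smul, norm_smul, h_norm_t]
  calc _ ≤ t * (C₁ * (Real.exp (-t) * (t ^ A + t ^ N₁))) +
        ‖2 * τ‖ * (C₁ * (Real.exp (-t) * (t ^ A + t ^ N₁))) +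
        ‖(τ - 1 / 2) ^ 2 - ω ^ 2‖ * (C₂ * (Real.exp (-t) * (t ^ A + t ^ N₂))) := by
        gcongr
        exacts [h₁ t ht, h₁ t ht, h₂ t ht]
    _ = C₁ * Real.exp (-t) * (t * (t ^ A + t ^ N₁)) +
        ‖2 * τ‖ * C₁ * Real.exp (-t) * (t ^ A + t ^ N₁) +
        ‖(τ - 1 / 2) ^ 2 - ω ^ 2‖ * C₂ * Real.exp (-t) * (t ^ A + t ^ N₂) := by ring
    _ ≤ C₁ * Real.exp (-t) * (2 * (t ^ A + t ^ N)) +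
        ‖2 * τ‖ * C₁ * Real.exp (-t) * (2 * (t ^ A + t ^ N)) +
        ‖(τ - 1 / 2) ^ 2 - ω ^ 2‖ * C₂ * Real.exp (-t) * (2 * (t ^ A + t ^ N)) := by gcongr
    _ = _ := by ring

theorem norm_cpow_smul_le_of_norm_le {f : ℝ → ℂ} {C A N : ℝ}
    (hf : ∀ t : ℝ, 0 < t → ‖f t‖ ≤ C * (Real.exp (-t) * (t ^ A + t ^ N))) (s : ℂ) {t : ℝ}
    (ht : 0 < t) :
    ‖(t : ℂ) ^ (s - 1) • f t‖ ≤ C * (t ^ (s.re + A - 1) * Real.exp (-(1 * t)) +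
      t ^ (s.re + N - 1) * Real.exp (-(1 * t))) := by
  have h_pow : ‖(t : ℂ) ^ (s - 1)‖ = t ^ (s.re - 1) := by
    simp [Complex.norm_cpow_eq_rpow_re_of_pos ht]
  rw [norm_smul, h_pow]
  calc _ ≤ t ^ (s.re - 1) * (C * (Real.exp (-t) * (t ^ A + t ^ N))) := by gcongr; exact hf t ht
    _ = _ := by
      rw [show s.re + A - 1 = s.re - 1 + A by ring, show s.re + N - 1 = s.re - 1 + N by ring,
        Real.rpow_add ht, Real.rpow_add ht, one_mul]
      ring

theorem integrableOn_rpow_add_rpow_mul_exp_neg {A N : ℝ} (hA : 0 < A) (hN : 0 < N) :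
    IntegrableOn (fun t : ℝ => t ^ (A - 1) * Real.exp (-(1 * t)) +
      t ^ (N - 1) * Real.exp (-(1 * t))) (Ioi 0) :=
  (integrableOn_rpow_mul_exp_neg hA one_pos).add (integrableOn_rpow_mul_exp_neg hN one_pos)

theorem mellinConvergent_of_norm_le {f : ℝ → ℂ} (hf_cont : ContinuousOn f (Ioi 0)) {C A N : ℝ}
    (hf : ∀ t : ℝ, 0 < t → ‖f t‖ ≤ C * (Real.exp (-t) * (t ^ A + t ^ N))) {s : ℂ}
    (hA : 0 < s.re + A) (hN : 0 < s.re + N) : MellinConvergent f s := by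
  refine ((integrableOn_rpow_add_rpow_mul_exp_neg hA hN).const_mul C).mono' ?_ ?_
  · have h_pow : ContinuousOn (fun t : ℝ => (t : ℂ) ^ (s - 1)) (Ioi 0) := fun t ht =>
      (hasDerivAt_ofReal_cpow (s - 1) ht).continuousAt.continuousWithinAt
    exact (h_pow.smul hf_cont).aestronglyMeasurable measurableSet_Ioi
  · filter_upwards [ae_restrict_mem measurableSet_Ioi] with t ht
    exact norm_cpow_smul_le_of_norm_le hf s ht

theorem integral_norm_cpow_smul_le_of_norm_le {f : ℝ → ℂ} {C A N : ℝ}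
    (hf : ∀ t : ℝ, 0 < t → ‖f t‖ ≤ C * (Real.exp (-t) * (t ^ A + t ^ N))) {s : ℂ}
    (hA : 0 < s.re + A) (hN : 0 < s.re + N) :
    ∫ t in Ioi (0 : ℝ), ‖(t : ℂ) ^ (s - 1) • f t‖ ≤
      C * (Real.Gamma (s.re + A) + Real.Gamma (s.re + N)) := by
  have h_Gamma : ∀ {x : ℝ}, 0 < x →
      ∫ t in Ioi (0 : ℝ), t ^ (x - 1) * Real.exp (-(1 * t)) = Real.Gamma x := fun hx => by
    rw [Real.integral_rpow_mul_exp_neg_mul_Ioi hx one_pos, div_one, Real.one_rpow, one_mul]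
  calc _ ≤ ∫ t in Ioi (0 : ℝ), C * (t ^ (s.re + A - 1) * Real.exp (-(1 * t)) +
        t ^ (s.re + N - 1) * Real.exp (-(1 * t))) := by
        refine integral_mono_of_nonneg (Eventually.of_forall fun t => norm_nonneg _)
          ((integrableOn_rpow_add_rpow_mul_exp_neg hA hN).const_mul C) ?_
        filter_upwards [ae_restrict_mem measurableSet_Ioi] with t ht
        exact norm_cpow_smul_le_of_norm_le hf s ht
    _ = _ := by
      rw [integral_const_mul, integral_add (integrableOn_rpow_mul_exp_neg hA one_pos)
        (integrableOn_rpow_mul_exp_neg hN one_pos), h_Gamma hA, h_Gamma hN]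

theorem mellinConvergent_whittakerWeight (τ : ℂ) {ω s : ℂ} (hs : |ω.re| < s.re + 1 / 2) :
    MellinConvergent (whittakerWeight τ ω) s := by
  obtain ⟨θ, hθ, hθs⟩ := exists_between hs
  obtain ⟨C, N, -, hN, h_bound⟩ := exists_norm_whittakerWeight_le τ hθ
  exact mellinConvergent_of_norm_le (continuousOn_whittakerWeight τ ω) h_bound (by linarith)
    (by linarith)

theorem exists_integral_norm_cpow_smul_whittakerWeight_le (τ ω : ℂ) :
    ∃ C N σ₀ : ℝ, ∀ s : ℂ, σ₀ ≤ s.re →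
      ∫ t in Ioi (0 : ℝ), ‖(t : ℂ) ^ (s - 1) • whittakerWeight τ ω t‖ ≤
        C * Real.Gamma (s.re + N) := by
  obtain ⟨θ, hθ⟩ := exists_gt |ω.re|
  obtain ⟨C, N, hC, hN, h_bound⟩ := exists_norm_whittakerWeight_le τ hθ
  refine ⟨2 * C, N, θ + 3 / 2, fun s hs => ?_⟩
  have h_mono : Real.Gamma (s.re + (1 / 2 - θ)) ≤ Real.Gamma (s.re + N) :=
    Real.Gamma_strictMonoOn_Ici.monotoneOn (mem_Ici.2 (by linarith)) (mem_Ici.2 (by linarith))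
      (by linarith)
  calc _ ≤ C * (Real.Gamma (s.re + (1 / 2 - θ)) + Real.Gamma (s.re + N)) :=
        integral_norm_cpow_smul_le_of_norm_le h_bound (by linarith) (by linarith)
    _ ≤ C * (Real.Gamma (s.re + N) + Real.Gamma (s.re + N)) :=
        mul_le_mul_of_nonneg_left (add_le_add_left h_mono _) hC
    _ = _ := by ring

theorem gammaQuotient_recurrence (τ : ℂ) {ω s : ℂ} (hs_add : 1 / 2 + ω + s ≠ 0)
    (hs_sub : 1 / 2 - ω + s ≠ 0) :
    Complex.Gamma (1 / 2 + ω + (s + 1)) * Complex.Gamma (1 / 2 - ω + (s + 1)) /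
        Complex.Gamma (1 - τ + (s + 1)) -
      2 * τ * (Complex.Gamma (1 / 2 + ω + s) * Complex.Gamma (1 / 2 - ω + s) /
        Complex.Gamma (1 - τ + s)) -
      ((τ - 1 / 2) ^ 2 - ω ^ 2) * (Complex.Gamma (1 / 2 + ω + s) * Complex.Gamma (1 / 2 - ω + s) /
        Complex.Gamma (1 - (τ - 1) + s)) =
    Complex.Gamma (1 / 2 + ω + s) * Complex.Gamma (1 / 2 - ω + s) /
      Complex.Gamma (1 - (τ + 1) + s) := by
  have hΓ := Complex.one_div_Gamma_eq_self_mul_one_div_Gamma_add_one (1 - τ + s)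
  have hΓ_pred := Complex.one_div_Gamma_eq_self_mul_one_div_Gamma_add_one (1 - (τ + 1) + s)
  rw [show 1 - (τ + 1) + s + 1 = 1 - τ + s by ring, hΓ] at hΓ_pred
  rw [← add_assoc, Complex.Gamma_add_one _ hs_add, ← add_assoc, Complex.Gamma_add_one _ hs_sub,
    ← add_assoc, show 1 - (τ - 1) + s = 1 - τ + s + 1 by ring,
    div_eq_mul_inv _ (Complex.Gamma (1 - τ + s)),
    div_eq_mul_inv _ (Complex.Gamma (1 - (τ + 1) + s)), hΓ_pred, hΓ]
  ring

theorem mellin_whittakerWeight_of_re_pos {τ ω s : ℂ} (hα : 0 < (1 / 2 + ω - τ).re)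
    (hs_add : 0 < (1 / 2 + ω + s).re) (hs_sub : 0 < (1 / 2 - ω + s).re) :
    mellin (whittakerWeight τ ω) s = Complex.Gamma (1 / 2 + ω + s) *
      Complex.Gamma (1 / 2 - ω + s) / Complex.Gamma (1 - τ + s) := by
  have hΓ : Complex.Gamma (1 / 2 + ω - τ) ≠ 0 := Complex.Gamma_ne_zero_of_re_pos hα
  have h_integrand : ∀ t ∈ Ioi (0 : ℝ), (t : ℂ) ^ (s - 1) • whittakerWeight τ ω t =
      (Complex.Gamma (1 / 2 + ω - τ))⁻¹ * ((t : ℂ) ^ (1 / 2 + ω + s - 1) * Complex.exp (-t) *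
        tricomiIntegral (1 / 2 + ω - τ) (ω + τ - 1 / 2) t) := by
    intro t ht
    have ht_ne : (t : ℂ) ≠ 0 := mod_cast (ne_of_gt ht)
    rw [whittakerWeight_eq_tricomiIntegral hα ht, smul_eq_mul,
      show 1 / 2 + ω + s - 1 = s - 1 + (1 / 2 + ω) by ring, Complex.cpow_add (s - 1) _ ht_ne]
    ring
  have h_sub : 1 / 2 + ω + s - (1 / 2 + ω - τ) - (ω + τ - 1 / 2) = 1 / 2 - ω + s := by ring
  rw [mellin, setIntegral_congr_fun measurableSet_Ioi h_integrand, integral_const_mul,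
    integral_cpow_mul_exp_neg_mul_tricomiIntegral hα hs_add (by rwa [h_sub]), h_sub,
    show 1 / 2 + ω + s - (ω + τ - 1 / 2) = 1 - τ + s by ring, mul_div_assoc, mul_left_comm,
    inv_mul_cancel_left₀ hΓ, mul_div_assoc]

theorem mellin_whittakerWeight_add_one (τ : ℂ) {ω s : ℂ} (hs : |ω.re| < s.re + 1 / 2) :
    mellin (whittakerWeight (τ + 1) ω) s = mellin (whittakerWeight τ ω) (s + 1) -
      2 * τ * mellin (whittakerWeight τ ω) s -
      ((τ - 1 / 2) ^ 2 - ω ^ 2) * mellin (whittakerWeight (τ - 1) ω) s := by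
  have hs_succ : |ω.re| < (s + 1).re + 1 / 2 := by
    rw [Complex.add_re, Complex.one_re]
    linarith
  have h_conv := mellinConvergent_whittakerWeight τ hs
  have h_conv_succ := MellinConvergent.cpow_smul.2 (mellinConvergent_whittakerWeight τ hs_succ)
  have h_conv_pred := mellinConvergent_whittakerWeight (τ - 1) hs
  have h_diff := hasMellin_sub h_conv_succ (h_conv.const_smul (2 * τ))
  calc _ = mellin (fun t => (t : ℂ) ^ (1 : ℂ) • whittakerWeight τ ω t -
        (2 * τ) • whittakerWeight τ ω t -
        ((τ - 1 / 2) ^ 2 - ω ^ 2) • whittakerWeight (τ - 1) ω t) s :=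
        setIntegral_congr_fun measurableSet_Ioi fun t ht => by
          simp only [whittakerWeight_recurrence τ ω ht]
    _ = _ := by
      rw [(hasMellin_sub h_diff.1 (h_conv_pred.const_smul _)).2, h_diff.2, mellin_cpow_smul,
        mellin_const_smul, mellin_const_smul, smul_eq_mul, smul_eq_mul]

theorem mellin_whittakerWeight (τ : ℂ) {ω s : ℂ} (hs : |ω.re| < s.re + 1 / 2) :
    mellin (whittakerWeight τ ω) s = Complex.Gamma (1 / 2 + ω + s) *
      Complex.Gamma (1 / 2 - ω + s) / Complex.Gamma (1 - τ + s) := by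
  have h_half : (1 / 2 : ℂ).re = 1 / 2 := by norm_num
  have hs_add : ∀ {s : ℂ}, |ω.re| < s.re + 1 / 2 → 0 < (1 / 2 + ω + s).re := fun hs => by
    rw [Complex.add_re, Complex.add_re, h_half]
    linarith [neg_abs_le ω.re]
  have hs_sub : ∀ {s : ℂ}, |ω.re| < s.re + 1 / 2 → 0 < (1 / 2 - ω + s).re := fun hs => by
    rw [Complex.add_re, Complex.sub_re, h_half]
    linarith [le_abs_self ω.re]
  have h_ne : ∀ {w : ℂ}, 0 < w.re → w ≠ 0 := fun hw h => by simp [h] at hw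
  refine whittaker_induction (P := fun τ => ∀ s : ℂ, |ω.re| < s.re + 1 / 2 →
      mellin (whittakerWeight τ ω) s = Complex.Gamma (1 / 2 + ω + s) *
        Complex.Gamma (1 / 2 - ω + s) / Complex.Gamma (1 - τ + s)) ω
    (fun τ hα s hs => mellin_whittakerWeight_of_re_pos hα (hs_add hs) (hs_sub hs))
    (fun τ ih ih_pred s hs => ?_) τ s hs
  have hs_succ : |ω.re| < (s + 1).re + 1 / 2 := by
    rw [Complex.add_re, Complex.one_re]
    linarith
  rw [mellin_whittakerWeight_add_one τ hs, ih _ hs_succ, ih s hs, ih_pred s hs,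
    gammaQuotient_recurrence τ (h_ne (hs_add hs)) (h_ne (hs_sub hs))]

/-! ### Growth of Gamma quotients -/

theorem Gamma_mul_rpow_le_Gamma_add {x b : ℝ} (hx : 1 < x) (hb : 0 ≤ b) :
    Real.Gamma x * (x - 1) ^ b ≤ Real.Gamma (x + b) := by
  rcases hb.eq_or_lt with rfl | hb
  · simp
  have hx_pred : 0 < x - 1 := by linarith
  have hΓ_pred : 0 < Real.Gamma (x - 1) := Real.Gamma_pos_of_pos hx_pred
  have hΓ : 0 < Real.Gamma x := Real.Gamma_pos_of_pos (by linarith)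
  have hΓ_add : 0 < Real.Gamma (x + b) := Real.Gamma_pos_of_pos (by linarith)
  have h_log : Real.log (Real.Gamma x) - Real.log (Real.Gamma (x - 1)) = Real.log (x - 1) := by
    conv_lhs => enter [1]; rw [← sub_add_cancel x 1]
    rw [Real.Gamma_add_one hx_pred.ne', Real.log_mul hx_pred.ne' hΓ_pred.ne', add_sub_cancel_right]
  have h_slope := Real.convexOn_log_Gamma.slope_mono_adjacent (x := x - 1) (y := x) (z := x + b)
    (mem_Ioi.2 hx_pred) (mem_Ioi.2 (by linarith : 0 < x + b)) (by linarith) (by linarith)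
  simp only [Function.comp_apply] at h_slope
  rw [h_log, sub_sub_cancel, div_one, add_sub_cancel_left, le_div_iff₀ hb] at h_slope
  rw [← Real.log_le_log_iff (by positivity) hΓ_add, Real.log_mul hΓ.ne' (by positivity),
    Real.log_rpow hx_pred]
  linarith

theorem integral_rpow_mul_one_add_rpow {a b : ℝ} (ha : 0 < a) (hb : 0 < b) :
    ∫ u in Ioi (0 : ℝ), u ^ (a - 1) * (1 + u) ^ (-(a + b)) =
      Real.Gamma a * Real.Gamma b / Real.Gamma (a + b) := by
  have h_beta := integral_cpow_mul_one_add_cpow (a := a) (b := b) (by simpa using ha)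
    (by simpa using hb)
  have h_real : ∀ u ∈ Ioi (0 : ℝ), (u : ℂ) ^ ((a : ℂ) - 1) * (1 + u : ℂ) ^ (-((a : ℂ) + b)) =
      ((u ^ (a - 1) * (1 + u) ^ (-(a + b)) : ℝ) : ℂ) := by
    intro u hu
    have hu_pos : 0 < u := hu
    push_cast [Complex.ofReal_cpow hu_pos.le, Complex.ofReal_cpow (by positivity : 0 ≤ 1 + u)]
    rfl
  rw [setIntegral_congr_fun measurableSet_Ioi h_real, integral_complex_ofReal,
    ← Complex.ofReal_add] at h_beta
  simp only [Complex.Gamma_ofReal] at h_beta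
  exact_mod_cast h_beta

theorem norm_Gamma_mul_Gamma_div_le {u v : ℂ} (hu : 0 < u.re) (hv : 0 < v.re) :
    ‖Complex.Gamma u * Complex.Gamma v / Complex.Gamma (u + v)‖ ≤
      Real.Gamma u.re * Real.Gamma v.re / Real.Gamma (u.re + v.re) := by
  rw [← integral_cpow_mul_one_add_cpow hu hv, ← integral_rpow_mul_one_add_rpow hu hv]
  refine (norm_integral_le_integral_norm _).trans_eq
    (setIntegral_congr_fun measurableSet_Ioi fun x hx => ?_)
  rw [norm_mul, Complex.norm_cpow_eq_rpow_re_of_pos hx, norm_one_add_ofReal_cpow hx]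
  simp

theorem exists_norm_inv_Gamma_ofReal_add_le {w : ℂ} (hw : 0 < w.re) :
    ∃ C : ℝ, 0 ≤ C ∧ ∀ x : ℝ, 0 < x →
      ‖(Complex.Gamma (x + w))⁻¹‖ ≤ C * (Real.Gamma (x + w.re))⁻¹ := by
  have hΓ_ne : Complex.Gamma w ≠ 0 := Complex.Gamma_ne_zero_of_re_pos hw
  refine ⟨Real.Gamma w.re * ‖(Complex.Gamma w)⁻¹‖,
    mul_nonneg (Real.Gamma_pos_of_pos hw).le (norm_nonneg _), fun x hx => ?_⟩
  have hΓ_x : 0 < Real.Gamma x := Real.Gamma_pos_of_pos hx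
  have h_beta := norm_Gamma_mul_Gamma_div_le (u := x) (by simpa using hx) hw
  rw [Complex.ofReal_re, Complex.Gamma_ofReal, mul_div_assoc, mul_div_assoc, norm_mul,
    Complex.norm_real, Real.norm_of_nonneg hΓ_x.le, mul_le_mul_iff_right₀ hΓ_x] at h_beta
  calc ‖(Complex.Gamma (x + w))⁻¹‖ = ‖(Complex.Gamma w)⁻¹‖ *
        ‖Complex.Gamma w / Complex.Gamma (x + w)‖ := by
        rw [← norm_mul, div_eq_mul_inv, inv_mul_cancel_left₀ hΓ_ne]
    _ ≤ ‖(Complex.Gamma w)⁻¹‖ * (Real.Gamma w.re / Real.Gamma (x + w.re)) := by gcongr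
    _ = _ := by ring

theorem eventually_lt_mul_natCast_add {b : ℝ} (hb : 0 < b) (m c : ℝ) :
    ∀ᶠ k : ℕ in atTop, c < b * k + m :=
  (tendsto_atTop_add_const_right _ m
    (tendsto_natCast_atTop_atTop.const_mul_atTop hb)).eventually_gt_atTop c

theorem exists_norm_inv_Gamma_mul_natCast_add_le {b : ℝ} (hb : 0 ≤ b) (w : ℂ) :
    ∃ C m : ℝ, 0 ≤ C ∧ (∀ᶠ k : ℕ in atTop, 1 < b * k + m) ∧ ∀ᶠ k : ℕ in atTop,
      ‖(Complex.Gamma (b * k + w))⁻¹‖ ≤ C * (Real.Gamma (b * k + m))⁻¹ := by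
  rcases hb.eq_or_lt with rfl | hb
  · exact ⟨‖(Complex.Gamma w)⁻¹‖, 2, norm_nonneg _, by norm_num, by simp⟩
  obtain ⟨K, hK⟩ := (eventually_lt_mul_natCast_add hb w.re 0).exists
  obtain ⟨C, hC, h_bound⟩ :=
    exists_norm_inv_Gamma_ofReal_add_le (w := b * K + w) (by simpa using hK)
  refine ⟨C, w.re, hC, eventually_lt_mul_natCast_add hb _ _, ?_⟩
  filter_upwards [eventually_gt_atTop K] with k hk
  have hkK : (0 : ℝ) < k - K := sub_pos.2 (mod_cast hk)
  convert h_bound (b * (k - K)) (by positivity) using 4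
  · push_cast
    ring
  · simp
    ring

theorem inv_Gamma_mul_succ_add_le {b m : ℝ} {k : ℕ} (hb : 0 ≤ b) (hk : 1 < b * k + m) :
    (Real.Gamma (b * (k + 1 : ℕ) + m))⁻¹ ≤
      (Real.Gamma (b * k + m))⁻¹ * ((b * k + (m - 1)) ^ b)⁻¹ := by
  have : 0 < Real.Gamma (b * k + m) := Real.Gamma_pos_of_pos (by linarith)
  have : 0 < b * k + (m - 1) := by linarith
  have h_growth := Gamma_mul_rpow_le_Gamma_add hk hb
  rw [← mul_inv]
  refine inv_anti₀ (by positivity) ?_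
  rwa [show b * ((k + 1 : ℕ) : ℝ) + m = b * k + m + b by push_cast; ring, ← add_sub_assoc]

theorem Gamma_two_mul_succ_add {σ : ℝ} {k : ℕ} (hk : 0 < 2 * k + σ) :
    Real.Gamma (2 * (k + 1 : ℕ) + σ) =
      (2 * k + (σ + 1)) * (2 * k + σ) * Real.Gamma (2 * k + σ) := by
  rw [show 2 * ((k + 1 : ℕ) : ℝ) + σ = 2 * k + σ + 1 + 1 by push_cast; ring,
    Real.Gamma_add_one (by positivity), Real.Gamma_add_one hk.ne']
  ring

theorem tendsto_mul_natCast_add_div (b m : ℝ) :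
    Tendsto (fun k : ℕ => (b * k + m) / k) atTop (𝓝 b) := by
  simpa [add_comm] using tendsto_add_mul_div_add_mul_atTop_nhds m 0 b one_ne_zero

theorem rpow_self_pos {b : ℝ} (hb : 0 ≤ b) : 0 < b ^ b := by
  rcases hb.eq_or_lt with rfl | hb
  · simp
  · positivity

theorem gammaQuotient_ratio_eq {l a σ m n r : ℝ} {k : ℕ} (hk : 0 < k) (hm : 0 < l * k + m)
    (hn : 0 < a * k + n) :
    r * ((2 * k + (σ + 1)) * (2 * k + σ)) * (((l * k + m) ^ l)⁻¹ * ((a * k + n) ^ a)⁻¹) =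
      r * ((2 * k + (σ + 1)) / k * ((2 * k + σ) / k)) *
        ((((l * k + m) / k) ^ l)⁻¹ * (((a * k + n) / k) ^ a)⁻¹) * (k : ℝ) ^ (-(l + a - 2)) := by
  have hk_pos : (0 : ℝ) < k := mod_cast hk
  rw [Real.div_rpow hm.le hk_pos.le, Real.div_rpow hn.le hk_pos.le, Real.rpow_neg hk_pos.le,
    Real.rpow_sub hk_pos, Real.rpow_add hk_pos, Real.rpow_two]
  field_simp

theorem exists_tendsto_gammaQuotient_ratio {l a σ m n r : ℝ} (hl : 0 ≤ l) (ha : 0 ≤ a)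
    (hm : ∀ᶠ k : ℕ in atTop, 0 < l * k + m) (hn : ∀ᶠ k : ℕ in atTop, 0 < a * k + n)
    (h : 2 < l + a ∨ (l + a = 2 ∧ 4 * r < l ^ l * a ^ a)) :
    ∃ ρ < 1, Tendsto (fun k : ℕ => r * ((2 * k + (σ + 1)) * (2 * k + σ)) *
      (((l * k + m) ^ l)⁻¹ * ((a * k + n) ^ a)⁻¹)) atTop (𝓝 ρ) := by
  have h_inv : ∀ {b : ℝ} (m : ℝ), 0 ≤ b →
      Tendsto (fun k : ℕ => (((b * k + m) / k) ^ b)⁻¹) atTop (𝓝 (b ^ b)⁻¹) := fun m hb =>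
    ((tendsto_mul_natCast_add_div _ m).rpow_const (Or.inr hb)).inv₀ (rpow_self_pos hb).ne'
  have h_main := (((tendsto_mul_natCast_add_div 2 (σ + 1)).mul
    (tendsto_mul_natCast_add_div 2 σ)).const_mul r).mul ((h_inv m hl).mul (h_inv n ha))
  obtain ⟨q, hq, h_tail⟩ : ∃ q, r * (2 * 2) * ((l ^ l)⁻¹ * (a ^ a)⁻¹) * q < 1 ∧
      Tendsto (fun k : ℕ => (k : ℝ) ^ (-(l + a - 2))) atTop (𝓝 q) := by
    rcases h with h | ⟨h, hr⟩
    · exact ⟨0, by simp,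
        (tendsto_rpow_neg_atTop (sub_pos.2 h)).comp tendsto_natCast_atTop_atTop⟩
    · refine ⟨1, ?_, by simp [h]⟩
      rw [mul_one, ← mul_inv, ← div_eq_mul_inv,
        div_lt_one (mul_pos (rpow_self_pos hl) (rpow_self_pos ha))]
      linarith
  refine ⟨_, hq, (h_main.mul h_tail).congr' ?_⟩
  filter_upwards [eventually_gt_atTop 0, hm, hn] with k hk hm hn
  exact (gammaQuotient_ratio_eq hk hm hn).symm

theorem summable_Gamma_mul_inv_Gamma {l a σ m n r : ℝ} (hl : 0 ≤ l) (ha : 0 ≤ a)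
    (hm : ∀ᶠ k : ℕ in atTop, 1 < l * k + m) (hn : ∀ᶠ k : ℕ in atTop, 1 < a * k + n)
    (hr : 0 ≤ r) (h : 2 < l + a ∨ (l + a = 2 ∧ 4 * r < l ^ l * a ^ a)) :
    Summable fun k : ℕ => Real.Gamma (2 * k + σ) * (Real.Gamma (l * k + m))⁻¹ *
      (Real.Gamma (a * k + n))⁻¹ * r ^ k := by
  obtain ⟨ρ, hρ, h_lim⟩ := exists_tendsto_gammaQuotient_ratio (σ := σ) (m := m - 1) (n := n - 1)
    hl ha (hm.mono fun k hk => by linarith) (hn.mono fun k hk => by linarith) h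
  obtain ⟨q, hρq, hq⟩ := exists_between hρ
  refine summable_of_ratio_norm_eventually_le hq ?_
  filter_upwards [h_lim.eventually_lt_const hρq, hm, hn,
    (tendsto_add_atTop_nat 1).eventually hm, (tendsto_add_atTop_nat 1).eventually hn,
    eventually_lt_mul_natCast_add two_pos σ 0] with k hk hm hn hm_succ hn_succ hσ
  have hΓ_pos : ∀ {x : ℝ}, 1 < x → 0 < Real.Gamma x := fun hx =>
    Real.Gamma_pos_of_pos (one_pos.trans hx)
  have := hΓ_pos hm
  have := hΓ_pos hn
  have := hΓ_pos hm_succ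
  have := hΓ_pos hn_succ
  have : 0 < Real.Gamma (2 * k + σ) := Real.Gamma_pos_of_pos hσ
  have hσ_succ : 0 < 2 * k + (σ + 1) := by linarith
  rw [Gamma_two_mul_succ_add hσ, Real.norm_of_nonneg (by positivity),
    Real.norm_of_nonneg (by positivity)]
  calc _ ≤ ((2 * k + (σ + 1)) * (2 * k + σ) * Real.Gamma (2 * k + σ)) *
        ((Real.Gamma (l * k + m))⁻¹ * ((l * k + (m - 1)) ^ l)⁻¹) *
        ((Real.Gamma (a * k + n))⁻¹ * ((a * k + (n - 1)) ^ a)⁻¹) * r ^ (k + 1) := by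
        have : 0 < l * k + (m - 1) := by linarith
        gcongr
        · exact inv_Gamma_mul_succ_add_le hl hm
        · exact inv_Gamma_mul_succ_add_le ha hn
    _ = (r * ((2 * k + (σ + 1)) * (2 * k + σ)) *
          (((l * k + (m - 1)) ^ l)⁻¹ * ((a * k + (n - 1)) ^ a)⁻¹)) *
        (Real.Gamma (2 * k + σ) * (Real.Gamma (l * k + m))⁻¹ *
          (Real.Gamma (a * k + n))⁻¹ * r ^ k) := by ring
    _ ≤ _ := by gcongr

theorem summable_Gamma_mul_norm_inv_Gamma {l a r : ℝ} (hl : 0 ≤ l) (ha : 0 ≤ a) (hr : 0 ≤ r)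
    (h : 2 < l + a ∨ (l + a = 2 ∧ 4 * r < l ^ l * a ^ a) ∨ r = 0) (σ : ℝ) (μ ν : ℂ) :
    Summable fun k : ℕ => Real.Gamma (2 * k + σ) * ‖(Complex.Gamma (l * k + μ))⁻¹‖ *
      ‖(Complex.Gamma (a * k + ν))⁻¹‖ * r ^ k := by
  rcases eq_or_ne r 0 with rfl | hr_ne
  · rw [← summable_nat_add_iff 1]
    simp [summable_zero]
  obtain ⟨C, m, hC, hm, h_l⟩ := exists_norm_inv_Gamma_mul_natCast_add_le hl μ
  obtain ⟨D, n, -, hn, h_a⟩ := exists_norm_inv_Gamma_mul_natCast_add_le ha ν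
  have h_summable := (summable_Gamma_mul_inv_Gamma (σ := σ) hl ha hm hn hr
    (by simpa [hr_ne] using h)).mul_left (C * D)
  refine h_summable.of_norm_bounded_eventually_nat ?_
  filter_upwards [h_l, h_a, hm, eventually_lt_mul_natCast_add two_pos σ 0]
    with k h_l h_a hm hσ
  have : 0 < Real.Gamma (l * k + m) := Real.Gamma_pos_of_pos (by linarith)
  have : 0 < Real.Gamma (2 * k + σ) := Real.Gamma_pos_of_pos hσ
  rw [Real.norm_of_nonneg (by positivity)]
  calc _ ≤ Real.Gamma (2 * k + σ) * (C * (Real.Gamma (l * k + m))⁻¹) *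
        (D * (Real.Gamma (a * k + n))⁻¹) * r ^ k := by gcongr
    _ = _ := by ring

/-! ### The Whittaker transform -/

theorem integrable_tsum_of_summable_integral_norm {X ι E : Type*} [MeasurableSpace X] [Countable ι]
    [NormedAddCommGroup E] [CompleteSpace E] {ρ : Measure X} {F : ι → X → E}
    (hF : ∀ i, Integrable (F i) ρ) (h_sum : Summable fun i => ∫ x, ‖F i x‖ ∂ρ) :
    Integrable (fun x => ∑' i, F i x) ρ := by
  have h_meas : ∀ i, AEMeasurable (fun x => ‖F i x‖ₑ) ρ := fun i => (hF i).1.enorm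
  have h_ne_top : ∫⁻ x, ∑' i, ‖F i x‖ₑ ∂ρ ≠ ⊤ := by
    rw [lintegral_tsum h_meas,
      tsum_congr fun i => (ofReal_integral_norm_eq_lintegral_enorm (hF i)).symm]
    exact h_sum.tsum_ofReal_ne_top
  have h_pointwise : ∀ᵐ x ∂ρ, Summable fun i => F i x := by
    filter_upwards [ae_lt_top' (AEMeasurable.tsum h_meas) h_ne_top] with x hx
    exact .of_norm (by simpa using ENNReal.summable_toReal hx.ne)
  refine ⟨aestronglyMeasurable_of_tendsto_ae atTop
    (fun s : Finset ι => Finset.aestronglyMeasurable_fun_sum s fun i _ => (hF i).1)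
    (h_pointwise.mono fun x hx => hx.hasSum), ?_⟩
  exact (lintegral_mono fun x => enorm_tsum_le_tsum_enorm).trans_lt h_ne_top.lt_top

theorem hasMellin_tsum_cpow_mul {ι : Type*} [Countable ι] {f : ℝ → ℂ} {A w : ι → ℂ} {s : ℂ}
    (hf : ∀ i, MellinConvergent f (s + w i))
    (h_sum : Summable fun i => ‖A i‖ * ∫ t in Ioi (0 : ℝ), ‖(t : ℂ) ^ (s + w i - 1) • f t‖) :
    HasMellin (fun t => (∑' i, A i * (t : ℂ) ^ w i) * f t) s
      (∑' i, A i * mellin f (s + w i)) := by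
  have h_int : ∀ i, IntegrableOn (fun t : ℝ => A i * ((t : ℂ) ^ (s + w i - 1) • f t)) (Ioi 0) :=
    fun i => (hf i).const_mul (A i)
  have h_norm : Summable fun i =>
      ∫ t in Ioi (0 : ℝ), ‖A i * ((t : ℂ) ^ (s + w i - 1) • f t)‖ := by
    simpa only [norm_mul, integral_const_mul] using h_sum
  have h_eq : EqOn (fun t : ℝ => ∑' i, A i * ((t : ℂ) ^ (s + w i - 1) • f t))
      (fun t => (t : ℂ) ^ (s - 1) • ((∑' i, A i * (t : ℂ) ^ w i) * f t)) (Ioi 0) := by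
    intro t ht
    have ht_ne : (t : ℂ) ≠ 0 := Complex.ofReal_ne_zero.2 (ne_of_gt ht)
    simp only [smul_eq_mul]
    rw [← tsum_mul_right, ← tsum_mul_left]
    refine tsum_congr fun i => ?_
    rw [add_sub_right_comm, Complex.cpow_add _ _ ht_ne]
    ring
  refine ⟨IntegrableOn.congr_fun (integrable_tsum_of_summable_integral_norm h_int h_norm) h_eq
    measurableSet_Ioi, ?_⟩
  rw [mellin, ← setIntegral_congr_fun measurableSet_Ioi h_eq,
    ← integral_tsum_of_summable_integral_norm h_int h_norm]
  simp only [integral_const_mul, mellin]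

theorem summable_mul_mellin {ι : Type*} {f : ℝ → ℂ} {A w : ι → ℂ}
    (h_sum : Summable fun i => ‖A i‖ * ∫ t in Ioi (0 : ℝ), ‖(t : ℂ) ^ (w i - 1) • f t‖) :
    Summable fun i => A i * mellin f (w i) :=
  h_sum.of_norm_bounded fun i => by
    rw [norm_mul]
    exact mul_le_mul_of_nonneg_left (norm_integral_le_integral_norm _) (norm_nonneg _)

theorem mul_ofReal_cpow {z s : ℂ} (h : z ≠ 0 ∨ s ≠ 0) {t : ℝ} (ht : 0 < t) :
    (z * t) ^ s = z ^ s * (t : ℂ) ^ s := by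
  have ht_ne : (t : ℂ) ≠ 0 := Complex.ofReal_ne_zero.2 ht.ne'
  rcases eq_or_ne z 0 with rfl | hz
  · simp [show s ≠ 0 by simpa using h]
  · rw [mul_comm, Complex.cpow_def_of_ne_zero (mul_ne_zero ht_ne hz),
      Complex.log_ofReal_mul ht hz, Complex.ofReal_log ht.le, add_mul, Complex.exp_add,
      ← Complex.cpow_def_of_ne_zero ht_ne, ← Complex.cpow_def_of_ne_zero hz, mul_comm]

/-- The coefficients of the generalized Galué type Struve function, with the factors `-c` and
`z ^ 2 / 4` of the consecutive terms merged into the single variable `y`. -/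
noncomputable def struveCoeff (a : ℕ) (p b : ℂ) (ξ l : ℝ) (μ y : ℂ) (k : ℕ) : ℂ :=
  y ^ k / (Complex.Gamma (l * k + μ) * Complex.Gamma (a * k + p / ξ + (b + 2) / 2))

theorem two_mul_natCast_add_ne_zero {p : ℂ} (hp : -1 < p.re) (k : ℕ) : 2 * (k : ℂ) + p + 1 ≠ 0 := by
  intro h
  have h_re : 2 * (k : ℝ) + p.re + 1 = 0 := by simpa using congrArg Complex.re h
  linarith [k.cast_nonneg (α := ℝ)]

theorem cpow_half_div_two_cpow {p x : ℂ} (hp : x ≠ 0 ∨ -1 < p.re) (k : ℕ) :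
    (x ^ (1 / 2 : ℂ) / 2) ^ (2 * k + p + 1 : ℂ) =
      (x ^ (1 / 2 : ℂ) / 2) ^ (p + 1) * (x / 4) ^ k := by
  have h_sq : (x ^ (1 / 2 : ℂ) / 2) ^ 2 = x / 4 := by
    rw [div_pow, one_div, Complex.cpow_ofNat_inv_pow]
    norm_num
  rcases eq_or_ne x 0 with rfl | hx
  · have hp_re : -1 < p.re := by simpa using hp
    have hp_ne : p + 1 ≠ 0 := by simpa using two_mul_natCast_add_ne_zero hp_re 0
    simp [Complex.zero_cpow hp_ne, Complex.zero_cpow (two_mul_natCast_add_ne_zero hp_re k)]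
  · have hz : x ^ (1 / 2 : ℂ) / 2 ≠ 0 := by simp [Complex.cpow_eq_zero_iff, hx]
    rw [show 2 * k + p + 1 = (p + 1) + ((2 * k : ℕ) : ℂ) by push_cast; ring,
      Complex.cpow_add _ _ hz, Complex.cpow_natCast, pow_mul, h_sq]

theorem galueStruve_cpow_half_mul (a : ℕ) {p x : ℂ} (hp : x ≠ 0 ∨ -1 < p.re) (b c : ℂ) (ξ l : ℝ)
    (μ : ℂ) {t : ℝ} (ht : 0 < t) :
    galueStruve a p b c ξ l μ (x ^ (1 / 2 : ℂ) * t) = (x ^ (1 / 2 : ℂ) / 2) ^ (p + 1) *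
      ∑' k : ℕ, struveCoeff a p b ξ l μ (-c * x / 4) k * (t : ℂ) ^ (2 * k + p + 1 : ℂ) := by
  rw [galueStruve, ← tsum_mul_left]
  refine tsum_congr fun k => ?_
  have h_ne : x ^ (1 / 2 : ℂ) / 2 ≠ 0 ∨ 2 * (k : ℂ) + p + 1 ≠ 0 :=
    hp.imp (fun hx => by simp [Complex.cpow_eq_zero_iff, hx])
      fun hp => two_mul_natCast_add_ne_zero hp k
  rw [mul_div_right_comm, mul_ofReal_cpow h_ne ht, cpow_half_div_two_cpow hp, struveCoeff,
    mul_div_assoc, mul_pow]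
  ring

theorem summable_norm_struveCoeff_mul_integral {a : ℕ} {l : ℝ} {y : ℂ} (hl : 0 ≤ l)
    (h : 2 < l + a ∨ (l + a = 2 ∧ 4 * ‖y‖ < l ^ l * (a : ℝ) ^ (a : ℝ)) ∨ y = 0)
    (p b μ τ ω s : ℂ) (ξ : ℝ) :
    Summable fun k : ℕ => ‖struveCoeff a p b ξ l μ y k‖ *
      ∫ t in Ioi (0 : ℝ), ‖(t : ℂ) ^ (s + (2 * k + p + 1) - 1) • whittakerWeight τ ω t‖ := by
  obtain ⟨C, N, σ₀, h_bound⟩ := exists_integral_norm_cpow_smul_whittakerWeight_le τ ω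
  have h_summable := (summable_Gamma_mul_norm_inv_Gamma hl a.cast_nonneg (norm_nonneg y)
    (by simpa using h) (s.re + p.re + 1 + N) μ (p / ξ + (b + 2) / 2)).mul_left C
  refine h_summable.of_norm_bounded_eventually_nat ?_
  filter_upwards [(eventually_lt_mul_natCast_add two_pos (s.re + p.re + 1) σ₀)] with k hk
  have h_re : (s + (2 * k + p + 1)).re = 2 * k + (s.re + p.re + 1) := by
    simp
    ring
  rw [Real.norm_of_nonneg (mul_nonneg (norm_nonneg _) (integral_nonneg fun t => norm_nonneg _))]
  calc _ ≤ ‖struveCoeff a p b ξ l μ y k‖ * (C * Real.Gamma (2 * k + (s.re + p.re + 1) + N)) := by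
        rw [← h_re]
        gcongr
        exact h_bound _ (h_re ▸ hk.le)
    _ = _ := by
        rw [struveCoeff, div_eq_mul_inv, mul_inv, norm_mul, norm_mul, norm_pow]
        simp only [Complex.ofReal_natCast, add_assoc]
        ring

theorem struveCoeff_mul_mellin_whittakerWeight (a : ℕ) (p b μ τ y : ℂ) {ω s : ℂ} (ξ l : ℝ) {k : ℕ}
    (h : |ω.re| < (s + (2 * k + p + 1)).re + 1 / 2) :
    struveCoeff a p b ξ l μ y k * mellin (whittakerWeight τ ω) (s + (2 * k + p + 1)) =
      wrightTerm ![(ω + s + p + 3 / 2, 2), (-ω + s + p + 3 / 2, 2), (1, 1)]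
        ![(μ, l), (p / ξ + b / 2 + 1, (a : ℝ)), (-τ + s + p + 2, 2)] y k := by
  have h_factorial : Complex.Gamma (1 + k) = k.factorial := by
    rw [add_comm, Complex.Gamma_nat_eq_factorial]
  have h_ne : (k.factorial : ℂ) ≠ 0 := mod_cast k.factorial_ne_zero
  simp only [mellin_whittakerWeight τ h, struveCoeff, wrightTerm, Fin.prod_univ_three,
    Matrix.cons_val_zero, Matrix.cons_val_one, Matrix.cons_val, Complex.ofReal_ofNat,
    Complex.ofReal_one, one_mul, h_factorial, Complex.ofReal_natCast]
  rw [show 1 / 2 + ω + (s + (2 * k + p + 1)) = ω + s + p + 3 / 2 + 2 * k by ring,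
    show 1 / 2 - ω + (s + (2 * k + p + 1)) = -ω + s + p + 3 / 2 + 2 * k by ring,
    show 1 - τ + (s + (2 * k + p + 1)) = -τ + s + p + 2 + 2 * k by ring,
    add_comm _ μ, show a * k + p / ξ + (b + 2) / 2 = p / ξ + b / 2 + 1 + a * k by ring,
    div_mul_div_comm, mul_right_comm _ (k.factorial : ℂ), mul_div_mul_right _ _ h_ne,
    mul_comm (y ^ k)]

theorem summable_wrightTerm_whittaker {a : ℕ} {l : ℝ} {p s ω y : ℂ} (hl : 0 ≤ l)
    (h : 2 < l + a ∨ (l + a = 2 ∧ 4 * ‖y‖ < l ^ l * (a : ℝ) ^ (a : ℝ)) ∨ y = 0)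
    (h_strip : ∀ k : ℕ, |ω.re| < (s + (2 * k + p + 1)).re + 1 / 2) (b μ τ : ℂ) (ξ : ℝ) :
    Summable (wrightTerm ![(ω + s + p + 3 / 2, 2), (-ω + s + p + 3 / 2, 2), (1, 1)]
      ![(μ, l), (p / ξ + b / 2 + 1, (a : ℝ)), (-τ + s + p + 2, 2)] y) :=
  (summable_mul_mellin (summable_norm_struveCoeff_mul_integral hl h p b μ τ ω s ξ)).congr
    fun k => struveCoeff_mul_mellin_whittakerWeight a p b μ τ y ξ l (h_strip k)

theorem hasMellin_tsum_struveCoeff_mul_whittakerWeight {a : ℕ} {l : ℝ} {p s ω y : ℂ} (hl : 0 ≤ l)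
    (h : 2 < l + a ∨ (l + a = 2 ∧ 4 * ‖y‖ < l ^ l * (a : ℝ) ^ (a : ℝ)) ∨ y = 0)
    (h_strip : ∀ k : ℕ, |ω.re| < (s + (2 * k + p + 1)).re + 1 / 2) (b μ τ : ℂ) (ξ : ℝ) :
    HasMellin (fun t => (∑' k : ℕ, struveCoeff a p b ξ l μ y k * (t : ℂ) ^ (2 * k + p + 1 : ℂ)) *
        whittakerWeight τ ω t) s
      (wrightPsi ![(ω + s + p + 3 / 2, 2), (-ω + s + p + 3 / 2, 2), (1, 1)]
        ![(μ, l), (p / ξ + b / 2 + 1, (a : ℝ)), (-τ + s + p + 2, 2)] y) := by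
  rw [wrightPsi, ← tsum_congr fun k =>
    struveCoeff_mul_mellin_whittakerWeight a p b μ τ y ξ l (h_strip k)]
  exact hasMellin_tsum_cpow_mul (fun k => mellinConvergent_whittakerWeight τ (h_strip k))
    (summable_norm_struveCoeff_mul_integral hl h p b μ τ ω s ξ)

theorem abs_re_lt_re_add_two_mul_natCast_add {p s ω : ℂ} (hplus : -(3 / 2) < (s + p + ω).re)
    (hminus : -(3 / 2) < (s + p - ω).re) (k : ℕ) :
    |ω.re| < (s + (2 * k + p + 1)).re + 1 / 2 := by
  have h_re : (s + (2 * k + p + 1)).re = (s + p).re + 1 + 2 * k := by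
    simp
    ring
  rw [Complex.add_re] at hplus
  rw [Complex.sub_re] at hminus
  rw [h_re, abs_lt]
  constructor <;> linarith [k.cast_nonneg (α := ℝ)]

theorem exp_sub_one_le_rpow_self {x : ℝ} (hx : 0 ≤ x) : Real.exp (x - 1) ≤ x ^ x := by
  rcases hx.eq_or_lt with rfl | hx
  · simp
  rw [Real.rpow_def_of_pos hx, Real.exp_le_exp]
  have h_log := mul_le_mul_of_nonneg_right (Real.one_sub_inv_le_log_of_pos hx) hx.le
  rwa [sub_mul, one_mul, inv_mul_cancel₀ hx.ne'] at h_log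

theorem one_le_rpow_self_mul_rpow_self {x y : ℝ} (hx : 0 ≤ x) (hy : 0 ≤ y) (h : x + y = 2) :
    1 ≤ x ^ x * y ^ y :=
  calc 1 = Real.exp (x - 1) * Real.exp (y - 1) := by
        rw [← Real.exp_add, show x - 1 + (y - 1) = 0 by linarith, Real.exp_zero]
    _ ≤ _ := by gcongr <;> exact exp_sub_one_le_rpow_self ‹_›

theorem theorem2p3_general (a : ℕ) (p b c μ τ ω ζ x : ℂ) (ξ l : ℝ) (_hξ : ξ ≠ 0) (hl : 0 ≤ l)
    (hp : x ≠ 0 ∨ -1 < p.re)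
    (hplus : -(3 / 2) < (ζ + p + ω).re) (hminus : -(3 / 2) < (ζ + p - ω).re)
    (hconv : 2 < l + a ∨ (l + a = 2 ∧ ‖c * x‖ < l ^ l * (a : ℝ) ^ (a : ℝ)) ∨ c * x = 0) :
    IntegrableOn (fun t : ℝ => (t : ℂ) ^ (ζ - 1) * Complex.exp (-(t : ℂ) / 2) *
        whittakerW τ ω t * galueStruve a p b c ξ l μ (x ^ (1 / 2 : ℂ) * t))
      (Ioi 0) ∧
    Summable (wrightTerm
      ![(ω + ζ + p + 3 / 2, 2), (-ω + ζ + p + 3 / 2, 2), (1, 1)]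
      ![(μ, l), (p / ξ + b / 2 + 1, (a : ℝ)), (-τ + ζ + p + 2, 2)]
      (-c * x / 4)) ∧
    ∫ t in Ioi (0 : ℝ), (t : ℂ) ^ (ζ - 1) * Complex.exp (-(t : ℂ) / 2) *
        whittakerW τ ω t * galueStruve a p b c ξ l μ (x ^ (1 / 2 : ℂ) * t) =
      (x ^ (1 / 2 : ℂ) / 2) ^ (p + 1) *
        wrightPsi
          ![(ω + ζ + p + 3 / 2, 2), (-ω + ζ + p + 3 / 2, 2), (1, 1)]
          ![(μ, l), (p / ξ + b / 2 + 1, (a : ℝ)), (-τ + ζ + p + 2, 2)]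
          (-c * x / 4) := by
  have h_strip := abs_re_lt_re_add_two_mul_natCast_add hplus hminus
  have h_conv : 2 < l + a ∨ (l + a = 2 ∧ 4 * ‖-c * x / 4‖ < l ^ l * (a : ℝ) ^ (a : ℝ)) ∨
      -c * x / 4 = 0 := by
    have h_norm : 4 * ‖-c * x / 4‖ = ‖c * x‖ := by
      simp only [norm_div, norm_mul, norm_neg, Complex.norm_ofNat]
      ring
    rw [h_norm]
    simpa using hconv
  obtain ⟨h_convergent, h_mellin⟩ :=
    hasMellin_tsum_struveCoeff_mul_whittakerWeight hl h_conv h_strip b μ τ ξ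
  have h_smul := hasMellin_const_smul h_convergent ((x ^ (1 / 2 : ℂ) / 2) ^ (p + 1))
  rw [h_mellin] at h_smul
  have h_integrand : EqOn (fun t : ℝ => (t : ℂ) ^ (ζ - 1) • (x ^ (1 / 2 : ℂ) / 2) ^ (p + 1) •
      ((∑' k : ℕ, struveCoeff a p b ξ l μ (-c * x / 4) k * (t : ℂ) ^ (2 * k + p + 1 : ℂ)) *
        whittakerWeight τ ω t)) (fun t : ℝ => (t : ℂ) ^ (ζ - 1) * Complex.exp (-(t : ℂ) / 2) *
        whittakerW τ ω t * galueStruve a p b c ξ l μ (x ^ (1 / 2 : ℂ) * t)) (Ioi 0) := by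
    intro t ht
    simp only [galueStruve_cpow_half_mul a hp b c ξ l μ ht, whittakerWeight, smul_eq_mul]
    ring
  refine ⟨IntegrableOn.congr_fun h_smul.1 h_integrand measurableSet_Ioi,
    summable_wrightTerm_whittaker hl h_conv h_strip b μ τ ξ, ?_⟩
  rw [← setIntegral_congr_fun measurableSet_Ioi h_integrand]
  exact h_smul.2

theorem theorem2p3 (a : ℕ) (ha : 0 < a) (p b c μ τ ω ζ x : ℂ) (ξ l : ℝ)
    (hξ : 0 < ξ) (hl : 0 < l) (hp : 0 < p.re) (hζ : 0 < ζ.re)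
    (hplus : -(1 / 2) < (ζ + ω).re) (hminus : -(1 / 2) < (ζ - ω).re)
    (hconv : 2 < l + a ∨ (l + a = 2 ∧ ‖c * x‖ < 1) ∨ c = 0) :
    IntegrableOn (fun t : ℝ => (t : ℂ) ^ (ζ - 1) * Complex.exp (-(t : ℂ) / 2) *
        whittakerW τ ω t * galueStruve a p b c ξ l μ (x ^ (1 / 2 : ℂ) * t))
      (Set.Ioi 0) ∧
    Summable (wrightTerm
      ![(ω + ζ + p + 3 / 2, 2), (-ω + ζ + p + 3 / 2, 2), (1, 1)]
      ![(μ, l), (p / ξ + b / 2 + 1, (a : ℝ)), (-τ + ζ + p + 2, 2)]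
      (-c * x / 4)) ∧
    ∫ t in Set.Ioi (0 : ℝ), (t : ℂ) ^ (ζ - 1) * Complex.exp (-(t : ℂ) / 2) *
        whittakerW τ ω t * galueStruve a p b c ξ l μ (x ^ (1 / 2 : ℂ) * t) =
      (x ^ (1 / 2 : ℂ) / 2) ^ (p + 1) *
        wrightPsi
          ![(ω + ζ + p + 3 / 2, 2), (-ω + ζ + p + 3 / 2, 2), (1, 1)]
          ![(μ, l), (p / ξ + b / 2 + 1, (a : ℝ)), (-τ + ζ + p + 2, 2)]
          (-c * x / 4) := by
  refine theorem2p3_general a p b c μ τ ω ζ x ξ l hξ.ne' hl.le (Or.inr (by linarith)) ?_ ?_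
    (hconv.imp_right (Or.imp (fun h => ⟨h.1, h.2.trans_le
      (one_le_rpow_self_mul_rpow_self hl.le a.cast_nonneg h.1)⟩) fun h => by rw [h, zero_mul]))
  · rw [add_right_comm, Complex.add_re]
    linarith
  · rw [add_sub_right_comm, Complex.add_re]
    linarith
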